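/- **Setting.** Let $K$ be a complete field extension of $\mathbb{Q}_p$, with absolute value $|\ |$ extending the $p$-adic one. Let $L\subseteq K$ be a finite extension of $\mathbb{Q}_p$, and let $G$ be the group of $L$-valued points of an $L$-split connected reductive group with maximal $L$-split torus $T$ and Borel subgroup $P\supseteq T$. All objects below depend on $(G,P,T)$ only through its based root datum: the character lattice $X^*(T)$, the cocharacter lattice $\Lambda$ of $T$ (identified with $T/T_0$, where $T_0\subseteq T$ is the maximal compact subgroup), the roots $\Phi\subset X^*(T)$ and coroots $\check\Phi\subset\Lambda$, the Weyl group $W$ acting on $\Lambda$ by $\lambda\mapsto{}^w\lambda$, and the positive roots $\Phi^+$ with the simple roots $\alpha_1,\dots,\alpha_d$. Let $\Lambda^{--}=\{\lambda\in\Lambda:\langle\alpha,\lambda\rangle\le 0\ \text{for all}\ \alpha\in\Phi^+\}$ be the set of antidominant cocharacters. The group law of $\Lambda$ is written multiplicatively. Let $\gamma:W\times\Lambda\to K^\times$ be a map such that, for all $v,w\in W$ and $\lambda,\mu\in\Lambda$: (a) $\gamma(w,\lambda\mu)=\gamma(w,\lambda)\gamma(w,\mu)$; (b) $\gamma(vw,\lambda)=\gamma(v,{}^w\lambda)\gamma(w,\lambda)$;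 (c) $|\gamma(w,\lambda)|\le 1$ if $\lambda\in\Lambda^{--}$; (d) $\gamma(w,\lambda)=1$ if ${}^w\lambda=\lambda$. Put $\gamma^{dom}(\lambda):=\gamma(w,\lambda)$ for any $w\in W$ with ${}^w\lambda\in\Lambda^{--}$, and let $K\langle\Lambda;\gamma\rangle$ be the Banach algebra obtained by completing the group ring $K[\Lambda]$ with respect to the norm $\|\sum_\lambda c_\lambda\lambda\|_\gamma:=\sup_\lambda|\gamma^{dom}(\lambda)c_\lambda|$. The twisted action $w\cdot\sum_\lambda c_\lambda\lambda:=\sum_\lambda\gamma(w,\lambda)c_\lambda\,{}^w\lambda$ of $W$ on $K[\Lambda]$ is isometric and extends by continuity to $K\langle\Lambda;\gamma\rangle$; let $K\langle\Lambda;\gamma\rangle^{W,\gamma}$ be the subalgebra of invariants, with the norm $\|\ \|_\gamma$. For $\lambda\in\Lambda^{--}$ let $\sigma_\lambda:=\sum_{w\in W/W(\lambda)}\gamma(w,\lambda)\,{}^w\lambda\in K\langle\Lambda;\gamma\rangle^{W,\gamma}$, where $W(\lambda)$ is the stabilizer of $\lambda$ in $W$. **Proposition 2.6.** Suppose that $G$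 is semisimple and adjoint, i.e. that the roots generate $X^*(T)$. Let $\lambda_1,\dots,\lambda_d\in\Lambda^{--}$ be the fundamental antidominant cocharacters, characterized by $\langle\alpha_j,\lambda_i\rangle=-\delta_{ij}$, and let $K\langle X_1,\dots,X_d\rangle$ be the Tate algebra of power series over $K$ whose coefficients tend to $0$, with the Gauss norm $\|\sum_m a_mX^m\|=\sup_m|a_m|$. Then there is a unique continuous $K$-algebra homomorphism $$K\langle X_1,\dots,X_d\rangle\longrightarrow K\langle\Lambda;\gamma\rangle^{W,\gamma},\qquad X_i\longmapsto\sigma_{\lambda_i},$$ and it is bijective and isometric. -/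

import Mathlib

noncomputable section

namespace BanachHecke

open RootPairing

section RootDatum

variable {ι X Λ : Type*} [AddCommGroup X] [AddCommGroup Λ]

/-- A root datum is semisimple if its roots span a subgroup of finite index in the lattice of
characters `X`, i.e. if every character has a nonzero multiple in the root lattice. -/
def IsSemisimple (P : RootDatum ι X Λ) : Prop :=
  ∀ x : X, ∃ n : ℤ, n ≠ 0 ∧ n • x ∈ Submodule.span ℤ (Set.range P.root)

/-- A root datum is adjoint if its roots generate the lattice of characters `X`. -/
def IsAdjoint (P : RootDatum ι X Λ) : Prop :=
  Submodule.span ℤ (Set.range P.root) = ⊤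

/-- The left action `(w, l) ↦ ʷl` of the Weyl group on the lattice of cocharacters. Mathlib lets the
automorphism `w` act on characters by `x ↦ w x` and on cocharacters by the transpose of this map;
the left action on cocharacters is the contragredient one, `⟨w x, ʷl⟩ = ⟨x, l⟩`. -/
instance weylAction (P : RootDatum ι X Λ) : DistribMulAction P.weylGroup Λ where
  smul w l := MulOpposite.op ((w : P.Aut)⁻¹) • l
  one_smul l := by
    change MulOpposite.op (((1 : P.weylGroup) : P.Aut)⁻¹) • l = l
    simp
  mul_smul v w l := by
    change MulOpposite.op (((v * w : P.weylGroup) : P.Aut)⁻¹) • l =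
      MulOpposite.op ((v : P.Aut)⁻¹) • MulOpposite.op ((w : P.Aut)⁻¹) • l
    rw [← mul_smul, ← MulOpposite.op_mul, ← mul_inv_rev]
    rfl
  smul_zero w := smul_zero (MulOpposite.op ((w : P.Aut)⁻¹))
  smul_add w := smul_add (MulOpposite.op ((w : P.Aut)⁻¹))

lemma weyl_smul_def (P : RootDatum ι X Λ) (w : P.weylGroup) (l : Λ) :
    w • l = ((w : P.Aut)⁻¹).coweightMap l := rfl

lemma pairing_coweightMap (P : RootDatum ι X Λ) (g : P.Aut) (x : X) (l : Λ) :
    P.toLinearMap x (g.coweightMap l) = P.toLinearMap (g • x) l :=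
  (LinearMap.congr_fun (Hom.weight_coweight_transpose_apply P P l g.toHom) x).symm

lemma pairing_weyl_smul (P : RootDatum ι X Λ) (w : P.weylGroup) (x : X) (l : Λ) :
    P.toLinearMap (w • x) (w • l) = P.toLinearMap x l := by
  rw [weyl_smul_def, pairing_coweightMap]
  change P.toLinearMap ((w : P.Aut)⁻¹ • (w : P.Aut) • x) l = _
  rw [inv_smul_smul]

lemma reflection_smul_cochar (P : RootDatum ι X Λ) (i : ι) (l : Λ) :
    weylGroup.ofIdx P i • l = l - P.toLinearMap (P.root i) l • P.coroot i := by
  rw [weyl_smul_def]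
  change ((Equiv.reflection P i)⁻¹).coweightMap l = _
  rw [Equiv.reflection_inv]
  exact P.coreflection_apply i l

/-- The Weyl group of a root datum is finite. -/
instance finite_weylGroup [Finite ι] (P : RootDatum ι X Λ) : Finite P.weylGroup := by
  have := Fintype.ofFinite ι
  have hspan : ∀ g : P.Aut, g ∈ P.weylGroup → ∀ x : X, g • x - x ∈ P.rootSpan ℤ := by
    intro g hg
    induction hg using weylGroup.induction with
    | mem i =>
      intro x
      rw [Equiv.reflection_smul, P.reflection_apply, sub_sub_cancel_left]
      exact neg_mem (Submodule.smul_mem _ _ (Submodule.subset_span ⟨i, rfl⟩))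
    | one => intro x; simp
    | mul g h _ _ hg' hh' =>
      intro x
      rw [mul_smul, ← sub_add_sub_cancel _ (h • x)]
      exact add_mem (hg' _) (hh' _)
  refine Finite.of_injective P.weylGroupToPerm ((injective_iff_map_eq_one _).2 fun w hw ↦ ?_)
  have hfix : ∀ x : X, (w : P.Aut) • x = x := by
    intro x
    rw [← sub_eq_zero]
    refine P.eq_zero_of_mem_rootSpan_of_rootForm_self_eq_zero (hspan _ w.2 x) ?_
    rw [P.rootForm_apply_apply]
    refine Finset.sum_eq_zero fun i _ ↦ ?_
    have h1 : P.toLinearMap ((w : P.Aut) • x) (P.coroot i) = P.toLinearMap x (P.coroot i) := by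
      have h2 : (w : P.Aut).coweightMap (P.coroot i) = P.coroot i := by
        rw [Hom.coroot_coweightMap_apply]
        congr 1
        rw [Equiv.symm_apply_eq]
        exact (congr($hw i)).symm
      rw [← pairing_coweightMap, h2]
    have h3 : P.coroot' i ((w : P.Aut) • x - x) = 0 := by
      simp [map_sub, RootPairing.coroot', h1]
    rw [h3, zero_mul]
  apply Subtype.ext
  apply Equiv.weightHom_injective P
  ext x
  exact hfix x

/-- A cocharacter `l` is antidominant with respect to the base `b` if `⟨α, l⟩ ≤ 0` for every
positive root `α`. -/
def Antidominant {P : RootDatum ι X Λ} (b : P.Base) (l : Λ) : Prop :=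
  ∀ i, b.IsPos i → P.toLinearMap (P.root i) l ≤ 0

/-- Every Weyl group orbit of cocharacters contains an antidominant one. -/
lemma exists_antidominant_smul [Finite ι] {P : RootDatum ι X Λ} [P.IsReduced] (b : P.Base) (l : Λ) :
    ∃ w : P.weylGroup, Antidominant b (w • l) := by
  classical
  have := Fintype.ofFinite ι
  let f : Λ →+ ℤ := ∑ i with b.IsPos i, (P.toLinearMap (P.root i)).toAddMonoidHom
  have hf : ∀ m, f m = ∑ i with b.IsPos i, P.toLinearMap (P.root i) m := by
    intro m
    simp [f, AddMonoidHom.finsetSum_apply]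
  have hf2 : ∀ j ∈ b.support, f (P.coroot j) = 2 := by
    intro j hj
    have hjp : j ∈ Finset.univ.filter (fun i ↦ b.IsPos i) := by
      simpa using Base.isPos_of_mem_support hj
    rw [hf, ← Finset.add_sum_erase _ _ hjp, P.root_coroot_two]
    have key : ∑ i ∈ (Finset.univ.filter (fun i ↦ b.IsPos i)).erase j,
        P.toLinearMap (P.root i) (P.coroot j) =
        ∑ i ∈ (Finset.univ.filter (fun i ↦ b.IsPos i)).erase j,
        -P.toLinearMap (P.root i) (P.coroot j) := by
      refine Finset.sum_nbij' (P.reflectionPerm j) (P.reflectionPerm j) ?_ ?_ ?_ ?_ ?_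
      all_goals
        intro i hi
        simp only [Finset.mem_erase, Finset.mem_filter, Finset.mem_univ, true_and] at hi ⊢
      iterate 2
        refine ⟨fun h ↦ ?_, Base.IsPos.reflectionPerm hi.2 hj hi.1⟩
        have := Base.IsPos.reflectionPerm hi.2 hj hi.1
        have h4 : P.root i = -P.root j := by
          have h5 := P.reflectionPerm_root j i
          rw [h] at h5
          have h6 : i = P.reflectionPerm j j := by
            rw [← P.reflectionPerm_self j i, h]
          rw [h6]
          simp
        let := P.indexNeg
        have h7 : i = -j := by
          apply P.root.injective
          simp [h4]
        have h8 := hi.2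
        rw [h7, Base.IsPos.neg_iff_not] at h8
        exact h8 (Base.isPos_of_mem_support hj)
      · simp
      · simp
      · rw [← P.reflectionPerm_root, map_sub, map_smul, LinearMap.sub_apply, LinearMap.smul_apply,
          P.root_coroot_two]
        simp
        ring
    rw [Finset.sum_neg_distrib] at key
    lia
  obtain ⟨w, hw⟩ := Finite.exists_min (fun w : P.weylGroup ↦ f (w • l))
  refine ⟨w, fun i hi ↦ ?_⟩
  have hs : ∀ j ∈ b.support, P.toLinearMap (P.root j) (w • l) ≤ 0 := by
    intro j hj
    have h := hw (weylGroup.ofIdx P j * w)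
    rw [mul_smul, reflection_smul_cochar, map_sub, map_zsmul, hf2 j hj] at h
    simp at h
    lia
  refine Base.IsPos.induction_on_add (p := fun i ↦ P.toLinearMap (P.root i) (w • l) ≤ 0) hi hs ?_
  intro i j k hk hi hj
  have := hs j hj
  simp only [hk, map_add, LinearMap.add_apply]
  lia

end RootDatum

section Fundamental

variable {ι X Λ : Type*} [AddCommGroup X] [AddCommGroup Λ]

/-- The simple roots of an adjoint root datum form a basis of the lattice of characters. -/
def simpleRootBasis {P : RootDatum ι X Λ} (b : P.Base) (hP : IsAdjoint P) :
    Module.Basis b.support ℤ X :=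
  Module.Basis.mk b.linearIndepOn_root <| by
    change ⊤ ≤ Submodule.span ℤ (Set.range (P.root ∘ ((↑) : b.support → ι)))
    rw [Set.range_comp, Subtype.range_coe_subtype]
    exact (b.span_int_root_support.trans hP).ge

@[simp] lemma simpleRootBasis_apply {P : RootDatum ι X Λ} (b : P.Base) (hP : IsAdjoint P)
    (i : b.support) : simpleRootBasis b hP i = P.root i := by
  simp [simpleRootBasis]

/-- The fundamental antidominant cocharacters `λ_i` of an adjoint root datum: `-λ_i` is the basis
of the lattice of cocharacters dual to the basis of simple roots. -/
def fundamentalAntidominant {P : RootDatum ι X Λ} (b : P.Base) (hP : IsAdjoint P)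
    (i : b.support) : Λ :=
  P.flip.toPerfPair.symm (-(simpleRootBasis b hP).coord i)

/-- The defining property of the fundamental antidominant cocharacters. -/
lemma pairing_fundamentalAntidominant {P : RootDatum ι X Λ} (b : P.Base) (hP : IsAdjoint P)
    (i j : b.support) [Decidable (j = i)] :
    P.toLinearMap (P.root j) (fundamentalAntidominant b hP i) = if j = i then -1 else 0 := by
  have h : P.flip.toPerfPair (fundamentalAntidominant b hP i) (P.root j) =
      (-(simpleRootBasis b hP).coord i) (P.root j) := by
    rw [fundamentalAntidominant, LinearEquiv.apply_symm_apply]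
  have h2 : P.root j = simpleRootBasis b hP j := (simpleRootBasis_apply b hP j).symm
  have h3 : P.toLinearMap (P.root j) (fundamentalAntidominant b hP i) =
    P.flip.toPerfPair (fundamentalAntidominant b hP i) (P.root j) := rfl
  rw [h3, h, h2, LinearMap.neg_apply, Module.Basis.coord_apply, Module.Basis.repr_self,
    Finsupp.single_apply]
  split_ifs <;> simp

end Fundamental

section Cocycle

variable {ι X Λ : Type*} [AddCommGroup X] [AddCommGroup Λ]

/-- The cocycles `γ : W × Λ → Kˣ` used for twisting: `γ` is multiplicative in the cocharacter,
satisfies the cocycle condition in the Weyl group element, has absolute value at most `1` on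
antidominant cocharacters, and is trivial at `(w, l)` if `w` fixes `l`. -/
structure WeylCocycle {P : RootDatum ι X Λ} (b : P.Base) (K : Type*) [NormedField K] where
  /-- The underlying map `W × Λ → Kˣ`. -/
  toFun : P.weylGroup → Λ → Kˣ
  map_add (w : P.weylGroup) (l m : Λ) : toFun w (l + m) = toFun w l * toFun w m
  map_mul (v w : P.weylGroup) (l : Λ) : toFun (v * w) l = toFun v (w • l) * toFun w l
  norm_le_one (w : P.weylGroup) (l : Λ) (hl : Antidominant b l) : ‖(toFun w l : K)‖ ≤ 1
  eq_one_of_fixed (w : P.weylGroup) (l : Λ) (hl : w • l = l) : toFun w l = 1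

variable {P : RootDatum ι X Λ} {b : P.Base} {K : Type*} [NormedField K] (γ : WeylCocycle b K)

namespace WeylCocycle

section Dom

variable [Finite ι] [P.IsReduced]

/-- `γ^dom l = γ(w, l)` for any `w` such that `ʷl` is antidominant (all such `w` give the same
value, since every orbit contains only one antidominant cocharacter and `γ` is trivial on
stabilizers). -/
def dom (l : Λ) : Kˣ := γ.toFun (exists_antidominant_smul b l).choose l

lemma norm_le_norm_dom (v : P.weylGroup) (l : Λ) : ‖(γ.toFun v l : K)‖ ≤ ‖(γ.dom l : K)‖ := by
  set w := (exists_antidominant_smul b l).choose with hw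
  have h := γ.map_mul (v * w⁻¹) w l
  rw [inv_mul_cancel_right] at h
  rw [h, dom, ← hw, Units.val_mul, norm_mul]
  exact mul_le_of_le_one_left (norm_nonneg _)
    (γ.norm_le_one _ _ (exists_antidominant_smul b l).choose_spec)

lemma norm_dom_add_le (l m : Λ) :
    ‖(γ.dom (l + m) : K)‖ ≤ ‖(γ.dom l : K)‖ * ‖(γ.dom m : K)‖ := by
  rw [dom, γ.map_add, Units.val_mul, norm_mul]
  exact mul_le_mul (γ.norm_le_norm_dom _ _) (γ.norm_le_norm_dom _ _) (norm_nonneg _) (norm_nonneg _)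

lemma norm_dom_smul (w : P.weylGroup) (l : Λ) :
    ‖(γ.dom (w • l) : K)‖ * ‖(γ.toFun w l : K)‖ = ‖(γ.dom l : K)‖ := by
  apply le_antisymm
  · rw [dom, ← norm_mul, ← Units.val_mul, ← γ.map_mul]
    exact γ.norm_le_norm_dom _ _
  · set v := (exists_antidominant_smul b l).choose with hv
    have h := γ.map_mul (v * w⁻¹) w l
    rw [inv_mul_cancel_right] at h
    rw [dom, ← hv, h, Units.val_mul, norm_mul]
    exact mul_le_mul_of_nonneg_right (γ.norm_le_norm_dom _ _) (norm_nonneg _)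

end Dom

lemma map_zero (w : P.weylGroup) : γ.toFun w 0 = 1 :=
  γ.eq_one_of_fixed w 0 (smul_zero w)

end WeylCocycle

/-- The algebra endomorphism `∑ c_l l ↦ ∑ γ(w, l) c_l ʷl` of the group ring `K[Λ]`. -/
def twistAux (w : P.weylGroup) : AddMonoidAlgebra K Λ →ₐ[K] AddMonoidAlgebra K Λ :=
  AddMonoidAlgebra.lift K (AddMonoidAlgebra K Λ) Λ
    { toFun := fun l ↦ AddMonoidAlgebra.single (w • l.toAdd) (γ.toFun w l.toAdd : K)
      map_one' := by
        rw [toAdd_one, smul_zero, γ.map_zero]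
        rfl
      map_mul' := fun l m ↦ by
        rw [AddMonoidAlgebra.single_mul_single, toAdd_mul, smul_add, γ.map_add, Units.val_mul] }

lemma twistAux_single (w : P.weylGroup) (l : Λ) (c : K) :
    twistAux γ w (AddMonoidAlgebra.single l c) =
      AddMonoidAlgebra.single (w • l) (γ.toFun w l * c) := by
  rw [twistAux, AddMonoidAlgebra.lift_single]
  simp [mul_comm]

/-- The group ring `K[Λ]`, regarded as a ring with norm `‖ ‖_γ`. -/
def TwistedGroupRing {P : RootDatum ι X Λ} {b : P.Base} {K : Type*} [NormedField K]
    (_γ : WeylCocycle b K) : Type _ := AddMonoidAlgebra K Λ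

namespace TwistedGroupRing

instance : CommRing (TwistedGroupRing γ) := inferInstanceAs (CommRing (AddMonoidAlgebra K Λ))

instance : Algebra K (TwistedGroupRing γ) := inferInstanceAs (Algebra K (AddMonoidAlgebra K Λ))

variable {γ}

/-- The coefficients `c_l` of an element `∑ c_l l` of the group ring. -/
def coeff (f : TwistedGroupRing γ) : Λ →₀ K := AddMonoidAlgebra.coeff f

variable (γ) in
/-- The element `c l` of the group ring. -/
def single (l : Λ) (c : K) : TwistedGroupRing γ := AddMonoidAlgebra.single l c

lemma coeff_add (f g : TwistedGroupRing γ) : (f + g).coeff = f.coeff + g.coeff :=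
  AddMonoidAlgebra.coeff_add f g

lemma coeff_smul (c : K) (f : TwistedGroupRing γ) : (c • f).coeff = c • f.coeff :=
  AddMonoidAlgebra.coeff_smul c f

variable (γ) in
/-- The algebra endomorphism `∑ c_l l ↦ ∑ γ(w, l) c_l ʷl` of the group ring. -/
def twist (w : P.weylGroup) : TwistedGroupRing γ →ₐ[K] TwistedGroupRing γ :=
  twistAux γ w

lemma twist_single (w : P.weylGroup) (l : Λ) (c : K) :
    twist γ w (single γ l c) = single γ (w • l) (γ.toFun w l * c) :=
  twistAux_single γ w l c

lemma induction_linear {p : TwistedGroupRing γ → Prop} (f : TwistedGroupRing γ) (h0 : p 0)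
    (hadd : ∀ f g, p f → p g → p (f + g)) (hs : ∀ l c, p (single γ l c)) : p f :=
  AddMonoidAlgebra.induction_linear f h0 hadd hs

lemma coeff_twist (w : P.weylGroup) (f : TwistedGroupRing γ) (l : Λ) :
    (twist γ w f).coeff (w • l) = γ.toFun w l * f.coeff l := by
  classical
  induction f using induction_linear with
  | h0 =>
    rw [_root_.map_zero]
    exact (mul_zero _).symm
  | hadd f g hf hg => simp only [_root_.map_add, coeff_add, Finsupp.add_apply, hf, hg, mul_add]
  | hs m c =>
    rw [twist_single]
    change Finsupp.single _ _ _ = _ * Finsupp.single _ _ _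
    rw [Finsupp.single_apply, Finsupp.single_apply]
    by_cases h : m = l
    · subst h; simp
    · simp [h]

lemma eq_sum (f : TwistedGroupRing γ) : f = ∑ l ∈ f.coeff.support, single γ l (f.coeff l) :=
  (AddMonoidAlgebra.sum_coeff_single f).symm

lemma single_mul_single (l m : Λ) (c d : K) :
    single γ l c * single γ m d = single γ (l + m) (c * d) :=
  AddMonoidAlgebra.single_mul_single _ _ _ _

end TwistedGroupRing

end Cocycle

section Norm

variable {ι X Λ : Type*} [AddCommGroup X] [AddCommGroup Λ] [Finite ι] {P : RootDatum ι X Λ}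
  [P.IsReduced] {b : P.Base} {K : Type*} [NormedField K] {γ : WeylCocycle b K}

namespace TwistedGroupRing

/-- The norm `‖∑ c_l l‖_γ = sup_l |γ^dom(l) c_l|`. -/
instance : Norm (TwistedGroupRing γ) := ⟨fun f ↦ ⨆ l, ‖(γ.dom l : K) * f.coeff l‖⟩

lemma norm_def (f : TwistedGroupRing γ) : ‖f‖ = ⨆ l, ‖(γ.dom l : K) * f.coeff l‖ := rfl

lemma le_norm (f : TwistedGroupRing γ) (l : Λ) : ‖(γ.dom l : K) * f.coeff l‖ ≤ ‖f‖ := by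
  refine le_ciSup (f := fun l ↦ ‖(γ.dom l : K) * f.coeff l‖) ?_ l
  refine ((f.coeff.hasFiniteSupport.image fun l ↦ ‖(γ.dom l : K) * f.coeff l‖).insert 0).bddAbove.mono
    ?_
  rintro - ⟨m, rfl⟩
  by_cases hm : f.coeff m = 0
  · left; simp [hm]
  · exact Or.inr ⟨m, hm, rfl⟩

lemma norm_le {f : TwistedGroupRing γ} {C : ℝ}
    (h : ∀ l, ‖(γ.dom l : K) * f.coeff l‖ ≤ C) : ‖f‖ ≤ C := ciSup_le h

lemma norm_nonneg' (f : TwistedGroupRing γ) : 0 ≤ ‖f‖ := (norm_nonneg _).trans (le_norm f 0)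

lemma norm_single (l : Λ) (c : K) : ‖single γ l c‖ = ‖(γ.dom l : K)‖ * ‖c‖ := by
  have h : ∀ m, (single γ l c).coeff m = Finsupp.single l c m := fun _ ↦ rfl
  apply le_antisymm
  · refine norm_le fun m ↦ ?_
    rw [h]
    by_cases hm : l = m
    · subst hm; simp
    · simp only [Finsupp.single_eq_of_ne' hm, mul_zero, norm_zero]
      positivity
  · simpa [h] using le_norm (single γ l c) l

lemma norm_twist (w : P.weylGroup) (f : TwistedGroupRing γ) : ‖twist γ w f‖ = ‖f‖ := by
  have key : ∀ l, ‖(γ.dom (w • l) : K) * (twist γ w f).coeff (w • l)‖ =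
      ‖(γ.dom l : K) * f.coeff l‖ := by
    intro l
    rw [coeff_twist, ← mul_assoc, norm_mul, norm_mul, γ.norm_dom_smul, norm_mul]
  apply le_antisymm
  · refine norm_le fun l ↦ ?_
    have h := key (w⁻¹ • l)
    rw [smul_inv_smul] at h
    exact h.trans_le (le_norm f _)
  · exact norm_le fun l ↦ (key l).symm.trans_le (le_norm _ _)

variable [IsUltrametricDist K]

lemma norm_add_le_max' (f g : TwistedGroupRing γ) : ‖f + g‖ ≤ max ‖f‖ ‖g‖ := by
  refine norm_le fun l ↦ ?_
  rw [coeff_add, Finsupp.add_apply, mul_add]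
  exact (IsUltrametricDist.norm_add_le_max _ _).trans (max_le_max (le_norm f l) (le_norm g l))

instance : NormedAddCommGroup (TwistedGroupRing γ) :=
  AddGroupNorm.toNormedAddCommGroup
    { toFun := norm
      map_zero' := by
        refine le_antisymm (norm_le fun l ↦ ?_) (norm_nonneg' _)
        change ‖_ * (0 : K)‖ ≤ 0
        simp
      add_le' := fun f g ↦ (norm_add_le_max' f g).trans
        (max_le_add_of_nonneg (norm_nonneg' f) (norm_nonneg' g))
      neg' := fun f ↦ by
        rw [norm_def, norm_def]
        congr 1
        ext l
        change ‖_ * -(f.coeff l)‖ = _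
        rw [mul_neg, norm_neg]
      eq_zero_of_map_eq_zero' := fun f hf ↦ by
        apply AddMonoidAlgebra.ext
        ext l
        have h := norm_le_zero_iff.1 ((le_norm f l).trans hf.le)
        exact (mul_eq_zero.1 h).resolve_left (γ.dom l).ne_zero }

instance : IsUltrametricDist (TwistedGroupRing γ) :=
  IsUltrametricDist.isUltrametricDist_of_forall_norm_add_le_max_norm norm_add_le_max'

lemma norm_mul_le' (f g : TwistedGroupRing γ) : ‖f * g‖ ≤ ‖f‖ * ‖g‖ := by
  have h0 : 0 ≤ ‖f‖ * ‖g‖ := mul_nonneg (norm_nonneg' f) (norm_nonneg' g)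
  rw [eq_sum f, eq_sum g, Finset.sum_mul_sum, ← eq_sum f, ← eq_sum g]
  refine IsUltrametricDist.norm_sum_le_of_forall_le_of_nonneg h0 fun l _ ↦
    IsUltrametricDist.norm_sum_le_of_forall_le_of_nonneg h0 fun m _ ↦ ?_
  rw [single_mul_single, norm_single, norm_mul]
  have h1 := le_norm f l
  have h2 := le_norm g m
  rw [norm_mul] at h1 h2
  calc ‖(γ.dom (l + m) : K)‖ * (‖f.coeff l‖ * ‖g.coeff m‖)
      ≤ (‖(γ.dom l : K)‖ * ‖(γ.dom m : K)‖) * (‖f.coeff l‖ * ‖g.coeff m‖) :=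
        mul_le_mul_of_nonneg_right (γ.norm_dom_add_le l m) (by positivity)
    _ = (‖(γ.dom l : K)‖ * ‖f.coeff l‖) * (‖(γ.dom m : K)‖ * ‖g.coeff m‖) := by ring
    _ ≤ ‖f‖ * ‖g‖ := mul_le_mul h1 h2 (by positivity) (norm_nonneg' f)

instance : NormedCommRing (TwistedGroupRing γ) where
  __ := (inferInstance : CommRing (TwistedGroupRing γ))
  __ := (inferInstance : NormedAddCommGroup (TwistedGroupRing γ))
  norm_mul_le := norm_mul_le'

instance : NormedAlgebra K (TwistedGroupRing γ) where
  norm_smul_le c f := by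
    refine norm_le fun l ↦ ?_
    rw [coeff_smul, Finsupp.smul_apply, smul_eq_mul, mul_left_comm, norm_mul]
    exact mul_le_mul_of_nonneg_left (le_norm f l) (norm_nonneg _)

lemma continuous_twist (w : P.weylGroup) : Continuous (twist γ w).toRingHom :=
  (AddMonoidHomClass.isometry_of_norm (twist γ w).toRingHom (norm_twist w)).continuous

end TwistedGroupRing

variable [IsUltrametricDist K]

variable (γ) in
/-- The Banach algebra `K⟨Λ; γ⟩`, the completion of `K[Λ]` with respect to `‖ ‖_γ`. -/
abbrev CompletedGroupRing : Type _ := UniformSpace.Completion (TwistedGroupRing γ)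

namespace CompletedGroupRing

variable (γ) in
/-- The twisted action of `w` on `K⟨Λ; γ⟩`, extending the one on `K[Λ]` by continuity. -/
def twist (w : P.weylGroup) : CompletedGroupRing γ →ₐ[K] CompletedGroupRing γ :=
  { UniformSpace.Completion.mapRingHom (TwistedGroupRing.twist γ w).toRingHom
      (TwistedGroupRing.continuous_twist w) with
    commutes' := fun c ↦
      (UniformSpace.Completion.mapRingHom_coe (TwistedGroupRing.continuous_twist w)
        (algebraMap K (TwistedGroupRing γ) c)).trans
        (congrArg _ ((TwistedGroupRing.twist γ w).commutes c)) }

lemma twist_coe (w : P.weylGroup) (f : TwistedGroupRing γ) :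
    twist γ w (f : CompletedGroupRing γ) = (TwistedGroupRing.twist γ w f : TwistedGroupRing γ) :=
  UniformSpace.Completion.mapRingHom_coe (TwistedGroupRing.continuous_twist w) f

variable (γ) in
/-- The Banach algebra `K⟨Λ; γ⟩^{W, γ}` of invariants under the twisted Weyl group action. -/
def invariants : Subalgebra K (CompletedGroupRing γ) where
  carrier := {f | ∀ w, twist γ w f = f}
  mul_mem' hf hg w := by rw [map_mul, hf w, hg w]
  add_mem' hf hg w := by rw [map_add, hf w, hg w]
  algebraMap_mem' c w := (twist γ w).commutes c

end CompletedGroupRing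

end Norm

section OrbitSum

variable {ι X Λ : Type*} [AddCommGroup X] [AddCommGroup Λ] [Finite ι] {P : RootDatum ι X Λ}
  {b : P.Base} {K : Type*} [NormedField K] (γ : WeylCocycle b K)

/-- The summand `w · l = γ(w, l) ʷl` of the twisted orbit sum; it depends only on the coset of `w`
modulo the stabilizer of `l`. -/
def orbitTerm (l : Λ) : P.weylGroup ⧸ MulAction.stabilizer P.weylGroup l → TwistedGroupRing γ :=
  Quotient.lift (fun w ↦ TwistedGroupRing.single γ (w • l) (γ.toFun w l : K)) <| by
    intro v w h
    have h' : (v⁻¹ * w) • l = l := QuotientGroup.leftRel_apply.1 h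
    have h1 : w • l = v • l := by rw [mul_smul, inv_smul_eq_iff] at h'; exact h'
    have h2 : γ.toFun w l = γ.toFun v l := by
      have := γ.map_mul v (v⁻¹ * w) l
      rwa [mul_inv_cancel_left, h', γ.eq_one_of_fixed _ _ h', mul_one] at this
    simp only [h1, h2]

/-- The twisted orbit sum `σ_l = ∑_{w ∈ W / W(l)} γ(w, l) ʷl` in `K[Λ]`. -/
def orbitSum (l : Λ) : TwistedGroupRing γ :=
  ∑ᶠ q : P.weylGroup ⧸ MulAction.stabilizer P.weylGroup l, orbitTerm γ l q

lemma twist_orbitSum (w : P.weylGroup) (l : Λ) :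
    TwistedGroupRing.twist γ w (orbitSum γ l) = orbitSum γ l := by
  have := Fintype.ofFinite (P.weylGroup ⧸ MulAction.stabilizer P.weylGroup l)
  rw [orbitSum, finsum_eq_sum_of_fintype, map_sum]
  refine Fintype.sum_equiv (MulAction.toPerm w) _ _ fun q ↦ ?_
  induction q using QuotientGroup.induction_on with
  | H v =>
    change TwistedGroupRing.twist γ w (TwistedGroupRing.single γ (v • l) (γ.toFun v l : K)) =
      TwistedGroupRing.single γ ((w * v) • l) (γ.toFun (w * v) l : K)
    rw [TwistedGroupRing.twist_single, γ.map_mul, mul_smul, Units.val_mul]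

/-- The twisted orbit sum `σ_l` as an element of `K⟨Λ; γ⟩^{W, γ}`. -/
def sigma [P.IsReduced] [IsUltrametricDist K] (l : Λ) : CompletedGroupRing.invariants γ :=
  ⟨(orbitSum γ l : TwistedGroupRing γ), fun w ↦ by
    rw [CompletedGroupRing.twist_coe, twist_orbitSum]⟩

end OrbitSum

section Tate

open MvPowerSeries
open scoped Topology

variable (K : Type*) [NormedField K] [IsUltrametricDist K] (σ : Type*)

/-- The Tate algebra `K⟨X_i : i ∈ σ⟩` of formal power series whose coefficients tend to zero. -/
def tateSubalgebra : Subalgebra K (MvPowerSeries σ K) where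
  carrier := {f | IsRestricted (fun _ ↦ 1) f}
  mul_mem' hf hg := isRestricted.mul _ hf hg
  add_mem' hf hg := isRestricted.add _ hf hg
  algebraMap_mem' c := isRestricted_C _ c

/-- The Tate algebra `K⟨X_i : i ∈ σ⟩`. -/
abbrev TateAlgebra : Type _ := tateSubalgebra K σ

namespace TateAlgebra

variable {K σ}

/-- The Gauss norm: the supremum of the absolute values of the coefficients. -/
instance : Norm (TateAlgebra K σ) := ⟨fun f ↦ ⨆ t : σ →₀ ℕ, ‖MvPowerSeries.coeff t f.1‖⟩

lemma norm_def (f : TateAlgebra K σ) : ‖f‖ = ⨆ t : σ →₀ ℕ, ‖MvPowerSeries.coeff t f.1‖ := rfl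

lemma norm_eq_gaussNorm (f : TateAlgebra K σ) : ‖f‖ = gaussNorm norm (fun _ ↦ 1) f.1 := by
  simp [norm_def, gaussNorm, Finsupp.prod]

lemma tendsto_coeff (f : TateAlgebra K σ) :
    Filter.Tendsto (fun t ↦ ‖MvPowerSeries.coeff t f.1‖) Filter.cofinite (𝓝 0) := by
  simpa [IsRestricted, Finsupp.prod] using (show IsRestricted (fun _ ↦ 1) f.1 from f.2)

lemma hasGaussNorm (f : TateAlgebra K σ) : HasGaussNorm norm (fun _ ↦ 1) f.1 := by
  have h := (tendsto_coeff f).bddAbove_range_of_cofinite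
  simpa [HasGaussNorm, Finsupp.prod] using h

lemma isNonarchimedean_norm : IsNonarchimedean (norm : K → ℝ) :=
  IsUltrametricDist.norm_add_le_max

instance : NormedAddCommGroup (TateAlgebra K σ) :=
  AddGroupNorm.toNormedAddCommGroup
    { toFun := norm
      map_zero' := by simp [norm_def]
      add_le' := fun f g ↦ by
        simp only [norm_eq_gaussNorm]
        refine (gaussNorm_add_le_max norm _ f.1 g.1 (fun _ ↦ zero_le_one) norm_nonneg
          isNonarchimedean_norm (hasGaussNorm f) (hasGaussNorm g)).trans
          (max_le_add_of_nonneg ?_ ?_)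
        all_goals exact gaussNorm_nonneg _ _ _ norm_nonneg
      neg' := fun f ↦ by simp [norm_def]
      eq_zero_of_map_eq_zero' := fun f hf ↦ by
        rw [norm_eq_gaussNorm] at hf
        exact Subtype.ext ((gaussNorm_eq_zero_iff norm _ f.1 norm_zero norm_nonneg
          (fun _ ↦ norm_eq_zero.1) (fun _ ↦ zero_lt_one) (hasGaussNorm f)).1 hf) }

instance : NormedCommRing (TateAlgebra K σ) where
  __ := (inferInstance : CommRing (TateAlgebra K σ))
  __ := (inferInstance : NormedAddCommGroup (TateAlgebra K σ))
  norm_mul_le f g := by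
    simp only [norm_eq_gaussNorm]
    exact gaussNorm_mul_le norm _ f.1 g.1 (fun _ ↦ zero_le_one) norm_nonneg
      norm_mul_le isNonarchimedean_norm norm_zero (hasGaussNorm f) (hasGaussNorm g)

instance : NormedAlgebra K (TateAlgebra K σ) where
  norm_smul_le c f := by
    rw [norm_def, norm_def, Real.mul_iSup_of_nonneg (norm_nonneg c)]
    refine le_of_eq (congrArg _ (funext fun t ↦ ?_))
    change ‖c * MvPowerSeries.coeff t f.1‖ = _
    rw [norm_mul]

variable (K) in
/-- The variable `X_i` of the Tate algebra. -/
def X (i : σ) : TateAlgebra K σ :=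
  ⟨MvPowerSeries.X i, isRestricted_monomial _ (Finsupp.single i 1) 1⟩

end TateAlgebra

end Tate

end BanachHecke

end

/-! The argument is triangularity with respect to a grading. Measure a cocharacter by its depth, the
sum of `-⟨α, l⟩` over the positive roots. In a Weyl orbit the antidominant member is unique and has
strictly the largest depth (`Antidominant.smul_eq`, `Antidominant.depth_smul_lt`). Hence `σ_l`, for
antidominant `l`, is `l` plus terms of smaller depth, and leading terms multiply. In the adjoint
case the antidominant cocharacters are the free commutative monoid on the `λ_i`, so each monomial in
the `σ_{λ_i}` has its own antidominant leading term, with coefficient `1`.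

This has two consequences. Algebraically, subtracting leading terms shows that the `σ_{λ_i}`
generate the invariants of `K[Λ]` (`mem_range_orbitSumHom`). Metrically, all `σ_{λ_i}` have norm at
most `1`, and the weight `γ^dom` has absolute value `1` at antidominant cocharacters. Reading off
the coefficient at a suitable leading term then shows that a polynomial in the `σ_{λ_i}` has exactly
its Gauss norm (`norm_coeff_le_norm_orbitSumHom`, `norm_sigmaHom`).

The isometry extends from polynomials to the Tate algebra by density. Its image is complete, hence
closed. It contains the average over `W` of every element of `K[Λ]`; averaging is continuous and, in
characteristic zero, fixes the invariants, so the image is everything (`surjective_of_apply_X`). -/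

noncomputable section

namespace BanachHecke

open RootPairing

/-! ### Words in simple reflections and uniqueness of antidominant representatives -/

section Words

variable {ι X Λ : Type*} [AddCommGroup X] [AddCommGroup Λ] {P : RootDatum ι X Λ}

lemma root_weyl_smul (w : P.weylGroup) (i : ι) : P.root (w • i) = w • P.root i :=
  Equiv.root_indexEquiv_eq_smul P i (w : P.Aut)

lemma coroot_weyl_smul (w : P.weylGroup) (i : ι) : P.coroot (w • i) = w • P.coroot i := by
  rw [weyl_smul_def, Hom.coroot_coweightMap_apply]
  rfl

lemma ofIdx_smul_idx (i j : ι) : weylGroup.ofIdx P i • j = P.reflectionPerm i j := rfl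

lemma pairing_weyl_smul_left (w : P.weylGroup) (i : ι) (l : Λ) :
    P.toLinearMap (P.root (w • i)) (w • l) = P.toLinearMap (P.root i) l := by
  rw [root_weyl_smul, pairing_weyl_smul]

lemma weylGroup_ext {v w : P.weylGroup} (h : ∀ x : X, v • x = w • x) : v = w := by
  apply Subtype.ext
  apply Equiv.weightHom_injective P
  ext x
  exact h x

lemma ofIdx_weyl_smul (w : P.weylGroup) (i : ι) :
    weylGroup.ofIdx P (w • i) = w * weylGroup.ofIdx P i * w⁻¹ := by
  rw [eq_mul_inv_iff_mul_eq]
  refine weylGroup_ext fun x ↦ ?_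
  rw [mul_smul, mul_smul, weylGroup.ofIdx_smul, weylGroup.ofIdx_smul, Equiv.reflection_smul,
    Equiv.reflection_smul, P.reflection_apply, P.reflection_apply, root_weyl_smul, smul_sub]
  have h : P.coroot' (w • i) (w • x) = P.coroot' i x := by
    change P.toLinearMap (w • x) (P.coroot (w • i)) = P.toLinearMap x (P.coroot i)
    rw [coroot_weyl_smul, pairing_weyl_smul]
  rw [h, smul_comm]

lemma ofIdx_mul_self (i : ι) : weylGroup.ofIdx P i * weylGroup.ofIdx P i = 1 := by
  rw [mul_eq_one_iff_eq_inv]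
  exact Subtype.ext (Equiv.reflection_inv P i).symm

/-- The element of the Weyl group represented by a word in the simple reflections. -/
def wordProd (b : P.Base) (L : List b.support) : P.weylGroup :=
  (L.map fun i ↦ weylGroup.ofIdx P i).prod

variable {b : P.Base}

@[simp] lemma wordProd_nil : wordProd b [] = 1 := rfl

@[simp] lemma wordProd_cons (i : b.support) (L : List b.support) :
    wordProd b (i :: L) = weylGroup.ofIdx P i * wordProd b L := by
  simp [wordProd]

@[simp] lemma wordProd_append (L M : List b.support) :
    wordProd b (L ++ M) = wordProd b L * wordProd b M := by
  simp [wordProd]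

lemma not_isPos_reflectionPerm_self {i : ι} (hi : b.IsPos i) :
    ¬ b.IsPos (P.reflectionPerm i i) := by
  -- Negation of root indices is by definition `i ↦ P.reflectionPerm i i`.
  have h := Base.IsPos.neg_iff_not b i
  exact fun h' ↦ h.1 h' hi

lemma Antidominant.pairing_nonneg {l : Λ} (hl : Antidominant b l) {i : ι} (hi : ¬ b.IsPos i) :
    0 ≤ P.toLinearMap (P.root i) l := by
  let := P.indexNeg
  simpa using hl _ ((Base.IsPos.or_neg b i).resolve_left hi)

variable [Finite ι] [P.IsReduced]

/-- A simple reflection permutes the positive roots other than its own simple root, so no other one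
changes sign. -/
lemma eq_of_not_isPos_reflectionPerm {i j : ι} (hi : b.IsPos i) (hj : j ∈ b.support)
    (h : ¬ b.IsPos (P.reflectionPerm j i)) : i = j := by
  by_contra hij
  exact h (hi.reflectionPerm hj hij)

/-- The exchange condition: if `w` maps a simple root `α_j` to a negative root, then `w s_j` has
a shorter word than the given one of `w`. -/
lemma exists_shorter_word (L : List b.support) (j : b.support)
    (h : ¬ b.IsPos (wordProd b L • (j : ι))) :
    ∃ M : List b.support, M.length < L.length ∧
      wordProd b M = wordProd b L * weylGroup.ofIdx P j := by
  induction L with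
  | nil => exact absurd (Base.isPos_of_mem_support j.2) (by simpa using h)
  | cons i L ih =>
    by_cases hL : b.IsPos (wordProd b L • (j : ι))
    -- Here the letter `i` causes the change of sign, so the tail maps `α_j` to `α_i` and conjugates
    -- `s_j` to `s_i`; multiplying by `s_j` deletes the letter `i`.
    · rw [wordProd_cons, mul_smul, ofIdx_smul_idx] at h
      have hi := eq_of_not_isPos_reflectionPerm hL i.2 h
      refine ⟨L, by simp, ?_⟩
      rw [wordProd_cons, ← hi, ofIdx_weyl_smul]
      simp [mul_assoc, ofIdx_mul_self]
    · obtain ⟨M, hM, hM'⟩ := ih hL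
      exact ⟨i :: M, by simpa using hM, by rw [wordProd_cons, hM', wordProd_cons, mul_assoc]⟩

/-- Every root comes from simple ones by negations and simple reflections, and the reflections in
`α` and `wα` are conjugate by `w`. -/
lemma exists_word (w : P.weylGroup) : ∃ L, wordProd b L = w := by
  have hrefl : ∀ i : ι, ∃ L, wordProd b L = weylGroup.ofIdx P i := by
    intro i
    refine b.induction_reflect i (p := fun i ↦ ∃ L, wordProd b L = weylGroup.ofIdx P i) ?_ ?_ ?_
    · rintro i ⟨L, hL⟩
      exact ⟨L, by rw [← ofIdx_smul_idx, ofIdx_weyl_smul, hL, mul_inv_cancel_right]⟩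
    · intro i hi
      exact ⟨[⟨i, hi⟩], by simp⟩
    · rintro i j ⟨L, hL⟩ hj
      refine ⟨⟨j, hj⟩ :: (L ++ [⟨j, hj⟩]), ?_⟩
      rw [← ofIdx_smul_idx, ofIdx_weyl_smul, ← eq_inv_of_mul_eq_one_left (ofIdx_mul_self j)]
      simp [hL, mul_assoc]
  obtain ⟨w, hw⟩ := w
  induction hw using weylGroup.induction with
  | mem i => exact hrefl i
  | one => exact ⟨[], rfl⟩
  | mul v w hv hw ihv ihw =>
    obtain ⟨L, hL⟩ := ihv
    obtain ⟨M, hM⟩ := ihw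
    exact ⟨L ++ M, by rw [wordProd_append, hL, hM]; rfl⟩

/-- Induction on the length of the word: either the exchange condition shortens it, or its last
letter fixes `l` and can be dropped. -/
lemma Antidominant.wordProd_smul_eq {l : Λ} (hl : Antidominant b l) (L : List b.support)
    (h : Antidominant b (wordProd b L • l)) : wordProd b L • l = l := by
  induction hn : L.length using Nat.strong_induction_on generalizing L with
  | h n ih =>
    rcases L.eq_nil_or_concat' with rfl | ⟨L, j, rfl⟩
    · simp
    · by_cases hj : b.IsPos (wordProd b (L ++ [j]) • (j : ι))
      -- If `w α_j` is positive, the prefix `w s_j` makes `α_j` negative. The exchange condition for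
      -- the prefix yields a word of `w` itself that is shorter than the prefix.
      · have hneg : ¬ b.IsPos (wordProd b L • (j : ι)) := by
          intro hpos
          have hself : b.IsPos (wordProd b (L ++ [j]) • P.reflectionPerm j j) := by
            simpa [mul_smul, ofIdx_smul_idx] using hpos
          have : wordProd b (L ++ [j]) • P.reflectionPerm j j =
              P.reflectionPerm (wordProd b (L ++ [j]) • (j : ι))
                (wordProd b (L ++ [j]) • (j : ι)) := by
            rw [← ofIdx_smul_idx, ← ofIdx_smul_idx, ofIdx_weyl_smul]
            simp [mul_smul]
          rw [this] at hself
          exact not_isPos_reflectionPerm_self hj hself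
        obtain ⟨M, hM, hM'⟩ := exists_shorter_word L j hneg
        have hM2 : wordProd b M = wordProd b (L ++ [j]) := by simpa using hM'
        rw [← hM2] at h ⊢
        exact ih M.length (by simp at hn; omega) M h rfl
      -- Since `w α_j` is negative, antidominance of `ʷl` gives `⟨α_j, l⟩ = ⟨w α_j, ʷl⟩ ≥ 0`.
      · have h0 : P.toLinearMap (P.root j) l = 0 := by
          refine le_antisymm (hl _ (Base.isPos_of_mem_support j.2)) ?_
          rw [← pairing_weyl_smul_left (wordProd b (L ++ [j]))]
          exact h.pairing_nonneg hj
        have h1 : wordProd b (L ++ [j]) • l = wordProd b L • l := by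
          simp [mul_smul, reflection_smul_cochar, h0]
        rw [h1] at h ⊢
        exact ih L.length (by simp at hn; omega) L h rfl

/-- Every Weyl group orbit of cocharacters contains only one antidominant one. -/
lemma Antidominant.smul_eq {l : Λ} (hl : Antidominant b l) {w : P.weylGroup}
    (h : Antidominant b (w • l)) : w • l = l := by
  obtain ⟨L, rfl⟩ := exists_word (b := b) w
  exact hl.wordProd_smul_eq L h

end Words

/-! ### The depth function on Weyl orbits -/

section Depth

variable {ι X Λ : Type*} [AddCommGroup X] [AddCommGroup Λ] {P : RootDatum ι X Λ}

/-- The sum of the `-⟨α, l⟩` over the positive roots `α`. -/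
def depth (b : P.Base) (l : Λ) : ℤ :=
  -∑ᶠ i : {i // b.IsPos i}, P.toLinearMap (P.root i) l

variable {b : P.Base}

lemma depth_add [Finite ι] (l m : Λ) : depth b (l + m) = depth b l + depth b m := by
  have := Fintype.ofFinite {i // b.IsPos i}
  simp only [depth, finsum_eq_sum_of_fintype, _root_.map_add, Finset.sum_add_distrib]
  ring

@[simp] lemma depth_zero : depth b (0 : Λ) = 0 := by simp [depth]

lemma Antidominant.depth_nonneg [Finite ι] {l : Λ} (hl : Antidominant b l) : 0 ≤ depth b l := by
  have := Fintype.ofFinite {i // b.IsPos i}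
  rw [depth, finsum_eq_sum_of_fintype, neg_nonneg]
  exact Finset.sum_nonpos fun i _ ↦ hl i i.2

/-- The roots `α` and `-α` contribute equally. Passing to a sum over all roots makes depth
comparable with the sum of the `|⟨α, l⟩|`, which is invariant under `W`. -/
lemma two_mul_depth [Fintype ι] [DecidablePred b.IsPos] (l : Λ) :
    2 * depth b l =
      ∑ i, (if b.IsPos i then -P.toLinearMap (P.root i) l else P.toLinearMap (P.root i) l) := by
  let := P.indexNeg
  have h1 : depth b l = ∑ i, if b.IsPos i then -P.toLinearMap (P.root i) l else 0 := by
    rw [depth, finsum_eq_sum_of_fintype, ← Finset.sum_neg_distrib,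
      ← Finset.sum_filter, Finset.sum_subtype (p := b.IsPos) _ (by simp)]
  have h2 : depth b l = ∑ i, if b.IsPos i then 0 else P.toLinearMap (P.root i) l := by
    rw [h1, ← Equiv.sum_comp (Equiv.neg ι)]
    refine Finset.sum_congr rfl fun i _ ↦ ?_
    simp only [Equiv.neg_apply, Base.IsPos.neg_iff_not]
    split_ifs <;> simp_all
  rw [two_mul]
  nth_rw 1 [h1]
  rw [h2, ← Finset.sum_add_distrib]
  refine Finset.sum_congr rfl fun i _ ↦ ?_
  split_ifs <;> simp

lemma depth_term_le [DecidablePred b.IsPos] (l : Λ) (i : ι) :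
    (if b.IsPos i then -P.toLinearMap (P.root i) l else P.toLinearMap (P.root i) l) ≤
      |P.toLinearMap (P.root i) l| := by
  split_ifs
  · exact neg_le_abs _
  · exact le_abs_self _

lemma sum_abs_pairing_smul [Fintype ι] (w : P.weylGroup) (l : Λ) :
    ∑ i, |P.toLinearMap (P.root i) (w • l)| = ∑ i, |P.toLinearMap (P.root i) l| := by
  rw [← Equiv.sum_comp (MulAction.toPerm w)]
  simp [pairing_weyl_smul_left]

lemma Antidominant.two_mul_depth_eq [Fintype ι] {l : Λ} (hl : Antidominant b l) :
    2 * depth b l = ∑ i, |P.toLinearMap (P.root i) l| := by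
  classical
  rw [two_mul_depth]
  refine Finset.sum_congr rfl fun i _ ↦ ?_
  split_ifs with hi
  · rw [abs_of_nonpos (hl i hi)]
  · rw [abs_of_nonneg (hl.pairing_nonneg hi)]

/-- Twice the depth is bounded by the `W`-invariant sum of the `|⟨α, l⟩|`, and antidominant
cocharacters attain the bound. -/
lemma Antidominant.depth_smul_le [Finite ι] {l : Λ} (hl : Antidominant b l) (w : P.weylGroup) :
    depth b (w • l) ≤ depth b l := by
  classical
  have := Fintype.ofFinite ι
  have h1 := hl.two_mul_depth_eq
  have h2 := two_mul_depth (b := b) (w • l)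
  have h3 := Finset.sum_le_sum fun i (_ : i ∈ Finset.univ) ↦ depth_term_le (b := b) (w • l) i
  rw [sum_abs_pairing_smul, ← h1, ← h2] at h3
  lia

/-- The antidominant cocharacter is the only one of maximal depth in its Weyl group orbit. -/
lemma Antidominant.depth_smul_lt [Finite ι] [P.IsReduced] {l : Λ} (hl : Antidominant b l) {w : P.weylGroup}
    (hw : w • l ≠ l) : depth b (w • l) < depth b l := by
  classical
  have := Fintype.ofFinite ι
  refine lt_of_le_of_ne (hl.depth_smul_le w) fun heq ↦ hw (hl.smul_eq fun i hi ↦ ?_)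
  have h1 := hl.two_mul_depth_eq
  have h2 := two_mul_depth (b := b) (w • l)
  -- Equality of the sums forces equality in each term, so `-⟨α, ʷl⟩` is an absolute value for each
  -- positive `α`, and `ʷl` is antidominant.
  have h3 := (Finset.sum_eq_sum_iff_of_le
    fun i (_ : i ∈ Finset.univ) ↦ depth_term_le (b := b) (w • l) i).1
      (by rw [sum_abs_pairing_smul, ← h1, ← h2, heq]) i (Finset.mem_univ i)
  rw [if_pos hi] at h3
  have := abs_nonneg (P.toLinearMap (P.root i) (w • l))
  lia

end Depth

/-! ### Antidominant cocharacters as a free commutative monoid -/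

section Fundamental

variable {ι X Λ : Type*} [AddCommGroup X] [AddCommGroup Λ] {P : RootDatum ι X Λ} {b : P.Base}

lemma eq_of_pairing_simpleRoot_eq (had : IsAdjoint P) {l m : Λ}
    (h : ∀ i : b.support, P.toLinearMap (P.root i) l = P.toLinearMap (P.root i) m) : l = m := by
  apply P.flip.toPerfPair.injective
  refine (simpleRootBasis b had).ext fun i ↦ ?_
  rw [simpleRootBasis_apply]
  exact h i

lemma antidominant_of_simple [Finite ι] {l : Λ}
    (h : ∀ i : b.support, P.toLinearMap (P.root i) l ≤ 0) : Antidominant b l := by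
  intro i hi
  refine Base.IsPos.induction_on_add (p := fun i ↦ P.toLinearMap (P.root i) l ≤ 0) hi
    (fun j hj ↦ h ⟨j, hj⟩) ?_
  intro i j k hk hi hj
  have := h ⟨j, hj⟩
  simp only [hk, _root_.map_add, LinearMap.add_apply]
  lia

/-- The antidominant cocharacter `∑ m_i λ_i`. -/
def expWeight (b : P.Base) (had : IsAdjoint P) (m : b.support →₀ ℕ) : Λ :=
  m.sum fun i n ↦ n • fundamentalAntidominant b had i

variable (had : IsAdjoint P)

lemma pairing_expWeight (m : b.support →₀ ℕ) (j : b.support) :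
    P.toLinearMap (P.root j) (expWeight b had m) = -(m j : ℤ) := by
  classical
  rw [expWeight, Finsupp.sum_fintype _ _ (by simp), map_sum]
  simp [pairing_fundamentalAntidominant]

lemma expWeight_injective : Function.Injective (expWeight b had) := by
  intro m n h
  ext j
  have h1 := pairing_expWeight had m j
  rw [h, pairing_expWeight] at h1
  lia

lemma antidominant_expWeight [Finite ι] (m : b.support →₀ ℕ) :
    Antidominant b (expWeight b had m) :=
  antidominant_of_simple fun i ↦ by rw [pairing_expWeight]; lia

lemma antidominant_fundamentalAntidominant [Finite ι] (i : b.support) :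
    Antidominant b (fundamentalAntidominant b had i) := by
  classical
  refine antidominant_of_simple fun j ↦ ?_
  rw [pairing_fundamentalAntidominant]
  split_ifs <;> simp

/-- Since the simple roots are a basis of the characters, `l` is determined by the integers `-⟨α_i,
l⟩`; antidominance makes them natural numbers, which serve as exponents. -/
lemma Antidominant.exists_expWeight_eq {l : Λ} (hl : Antidominant b l) :
    ∃ m, expWeight b had m = l := by
  refine ⟨Finsupp.equivFunOnFinite.symm fun i ↦ (P.toLinearMap (P.root i) l).natAbs,
    eq_of_pairing_simpleRoot_eq (b := b) had fun j ↦ ?_⟩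
  have := hl _ (Base.isPos_of_mem_support j.2)
  rw [pairing_expWeight, Finsupp.equivFunOnFinite_symm_apply_apply]
  lia

end Fundamental

end BanachHecke

end

noncomputable section

namespace BanachHecke

open RootPairing

namespace TwistedGroupRing

/-! ### Leading terms in the group ring -/

section Coeff

variable {ι X Λ : Type*} [AddCommGroup X] [AddCommGroup Λ] {P : RootDatum ι X Λ} {b : P.Base}
  {K : Type*} [NormedField K] {γ : WeylCocycle b K}

variable (γ) in
/-- The coefficient at `l` as a linear form. -/
def coeffLin (l : Λ) : TwistedGroupRing γ →ₗ[K] K where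
  toFun f := f.coeff l
  map_add' f g := by rw [coeff_add, Finsupp.add_apply]
  map_smul' c f := by rw [coeff_smul, Finsupp.smul_apply, RingHom.id_apply]

lemma coeffLin_apply (l : Λ) (f : TwistedGroupRing γ) : coeffLin γ l f = f.coeff l := rfl

lemma coeff_single_self (l : Λ) (c : K) : (single γ l c).coeff l = c :=
  Finsupp.single_eq_same

lemma coeff_single_of_ne {l m : Λ} (h : l ≠ m) (c : K) : (single γ l c).coeff m = 0 :=
  Finsupp.single_eq_of_ne' h

lemma ext_coeff {f g : TwistedGroupRing γ} (h : ∀ l, f.coeff l = g.coeff l) : f = g :=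
  AddMonoidAlgebra.ext (Finsupp.ext h)

lemma one_eq_single : (1 : TwistedGroupRing γ) = single γ 0 1 := rfl

variable (γ) in
/-- The elements of the group ring supported on cocharacters of depth less than `c`. -/
def depthLT (c : ℤ) : Submodule K (TwistedGroupRing γ) where
  carrier := {f | ∀ l, f.coeff l ≠ 0 → depth b l < c}
  zero_mem' l h := absurd (_root_.map_zero (coeffLin γ l)) h
  add_mem' {f g} hf hg l h := by
    rw [coeff_add, Finsupp.add_apply] at h
    by_cases hl : f.coeff l = 0
    · exact hg l fun h' ↦ h (by rw [hl, h', add_zero])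
    · exact hf l hl
  smul_mem' a f hf l h := by
    rw [coeff_smul, Finsupp.smul_apply] at h
    exact hf l (right_ne_zero_of_smul h)

lemma single_mem_depthLT {c : ℤ} {l : Λ} (hl : depth b l < c) (a : K) :
    single γ l a ∈ depthLT γ c := by
  intro m hm
  by_cases h : l = m
  · exact h ▸ hl
  · exact absurd (coeff_single_of_ne h a) hm

lemma depthLT_mono {c d : ℤ} (h : c ≤ d) : depthLT γ c ≤ depthLT γ d :=
  fun _ hf l hl ↦ (hf l hl).trans_le h

variable [Finite ι]

/-- Depth is additive and integral, so the two strict bounds combine to one that is better by `1`.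
This gain absorbs the `+ 1` needed to place `single l 1` itself in the filtration. -/
lemma mul_mem_depthLT {c d : ℤ} {f g : TwistedGroupRing γ} (hf : f ∈ depthLT γ c)
    (hg : g ∈ depthLT γ d) : f * g ∈ depthLT γ (c + d - 1) := by
  rw [eq_sum f, eq_sum g, Finset.sum_mul_sum]
  refine Submodule.sum_mem _ fun l hl ↦ Submodule.sum_mem _ fun m hm ↦ ?_
  rw [single_mul_single]
  have h1 := hf l (Finsupp.mem_support_iff.1 hl)
  have h2 := hg m (Finsupp.mem_support_iff.1 hm)
  exact single_mem_depthLT (by rw [depth_add]; lia) _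

/-- `f` has leading term `l`, i.e. `f` is the sum of `l` and of terms of smaller depth. -/
def HasLead (f : TwistedGroupRing γ) (l : Λ) : Prop :=
  f - single γ l 1 ∈ depthLT γ (depth b l)

omit [Finite ι] in
lemma HasLead.one : HasLead (1 : TwistedGroupRing γ) 0 := by
  rw [HasLead, one_eq_single, sub_self]
  exact zero_mem _

lemma HasLead.mul {f g : TwistedGroupRing γ} {l m : Λ} (hf : HasLead f l) (hg : HasLead g m) :
    HasLead (f * g) (l + m) := by
  have h1 := mul_mem_depthLT (single_mem_depthLT (γ := γ) (lt_add_one (depth b l)) 1) hg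
  have h2 := mul_mem_depthLT hf (single_mem_depthLT (γ := γ) (lt_add_one (depth b m)) 1)
  have h3 := mul_mem_depthLT hf hg
  have h4 : single γ l 1 * single γ m 1 = single γ (l + m) (1 : K) := by
    rw [single_mul_single, mul_one]
  have key : f * g - single γ (l + m) 1 = single γ l 1 * (g - single γ m 1) +
      (f - single γ l 1) * single γ m 1 + (f - single γ l 1) * (g - single γ m 1) := by
    rw [← h4]; ring
  rw [HasLead, key, depth_add]
  exact add_mem (add_mem (depthLT_mono (by lia) h1) (depthLT_mono (by lia) h2))
    (depthLT_mono (by lia) h3)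

lemma HasLead.pow {f : TwistedGroupRing γ} {l : Λ} (hf : HasLead f l) (n : ℕ) :
    HasLead (f ^ n) (n • l) := by
  induction n with
  | zero => simpa using HasLead.one
  | succ n ih => rw [pow_succ, succ_nsmul]; exact ih.mul hf

lemma HasLead.prod {κ : Type*} {s : Finset κ} {f : κ → TwistedGroupRing γ} {l : κ → Λ}
    (h : ∀ i ∈ s, HasLead (f i) (l i)) : HasLead (∏ i ∈ s, f i) (∑ i ∈ s, l i) := by
  classical
  induction s using Finset.induction_on with
  | empty => simpa using HasLead.one
  | insert i s hi ih =>
    rw [Finset.prod_insert hi, Finset.sum_insert hi]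
    exact (h i (by simp)).mul (ih fun j hj ↦ h j (by simp [hj]))

omit [Finite ι] in
lemma HasLead.coeff_eq_one {f : TwistedGroupRing γ} {l : Λ} (h : HasLead f l) :
    f.coeff l = 1 := by
  have h1 := map_sub (coeffLin γ l) f (single γ l 1)
  simp only [coeffLin_apply, coeff_single_self] at h1
  by_contra hne
  exact lt_irrefl _ (h l (by rw [h1]; exact sub_ne_zero.2 hne))

omit [Finite ι] in
lemma HasLead.depth_lt {f : TwistedGroupRing γ} {l m : Λ} (h : HasLead f l) (hm : l ≠ m)
    (hf : f.coeff m ≠ 0) : depth b m < depth b l := by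
  have h1 := map_sub (coeffLin γ m) f (single γ l 1)
  simp only [coeffLin_apply, coeff_single_of_ne hm, sub_zero] at h1
  exact h m (by rwa [h1])

end Coeff

/-! ### Leading term and norm of the twisted orbit sums -/

section OrbitSum

variable {ι X Λ : Type*} [AddCommGroup X] [AddCommGroup Λ] [Finite ι] {P : RootDatum ι X Λ}
  [P.IsReduced] {b : P.Base} {K : Type*} [NormedField K] {γ : WeylCocycle b K}

/-- The trivial coset contributes `l`; any other coset moves `l` and so lowers its depth. -/
lemma hasLead_orbitSum {l : Λ} (hl : Antidominant b l) : HasLead (orbitSum γ l) l := by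
  classical
  have := Fintype.ofFinite (P.weylGroup ⧸ MulAction.stabilizer P.weylGroup l)
  have h1 : orbitTerm γ l (QuotientGroup.mk 1) = single γ l 1 := by
    change single γ ((1 : P.weylGroup) • l) (γ.toFun 1 l : K) = _
    rw [one_smul, γ.eq_one_of_fixed 1 l (one_smul _ l), Units.val_one]
  rw [HasLead, orbitSum, finsum_eq_sum_of_fintype,
    ← Finset.add_sum_erase _ _ (Finset.mem_univ (QuotientGroup.mk 1)), h1, add_sub_cancel_left]
  refine Submodule.sum_mem _ fun q hq ↦ ?_
  induction q using QuotientGroup.induction_on with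
  | H w =>
    refine single_mem_depthLT (hl.depth_smul_lt fun hw ↦ Finset.ne_of_mem_erase hq ?_) _
    refine (QuotientGroup.eq.2 ?_).symm
    simpa using hw

/-- The lower bound is the maximality of `γ^dom` over `W`, applied to `w = 1`. -/
lemma norm_dom_eq_one {l : Λ} (hl : Antidominant b l) : ‖(γ.dom l : K)‖ = 1 := by
  refine le_antisymm (γ.norm_le_one _ _ hl) ?_
  have h := γ.norm_le_norm_dom 1 l
  rwa [γ.eq_one_of_fixed 1 l (one_smul _ l), Units.val_one, norm_one] at h

lemma norm_coeff_le {l : Λ} (hl : Antidominant b l) (f : TwistedGroupRing γ) :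
    ‖f.coeff l‖ ≤ ‖f‖ := by
  simpa [norm_dom_eq_one hl] using le_norm f l

variable [IsUltrametricDist K]

instance : NormOneClass (TwistedGroupRing γ) where
  norm_one := by
    rw [one_eq_single, norm_single, norm_one, mul_one]
    exact norm_dom_eq_one fun i _ ↦ by simp

/-- Twisting is isometric, so each summand has the norm of `l`, which is `1`. -/
lemma norm_orbitSum_le {l : Λ} (hl : Antidominant b l) : ‖orbitSum γ l‖ ≤ 1 := by
  have := Fintype.ofFinite (P.weylGroup ⧸ MulAction.stabilizer P.weylGroup l)
  rw [orbitSum, finsum_eq_sum_of_fintype]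
  refine IsUltrametricDist.norm_sum_le_of_forall_le_of_nonneg zero_le_one fun q _ ↦ ?_
  induction q using QuotientGroup.induction_on with
  | H w =>
    change ‖single γ (w • l) (γ.toFun w l : K)‖ ≤ 1
    rw [norm_single, γ.norm_dom_smul, norm_dom_eq_one hl]

end OrbitSum

end TwistedGroupRing

/-! ### Polynomials in the fundamental orbit sums -/

section Polynomial

open TwistedGroupRing

variable {ι X Λ : Type*} [AddCommGroup X] [AddCommGroup Λ] [Finite ι] {P : RootDatum ι X Λ}
  {b : P.Base} {K : Type*} [NormedField K] (γ : WeylCocycle b K) (had : IsAdjoint P)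

/-- The homomorphism from the polynomial ring to the group ring mapping the variables to the
twisted orbit sums of the fundamental antidominant cocharacters. -/
def orbitSumHom : MvPolynomial b.support K →ₐ[K] TwistedGroupRing γ :=
  MvPolynomial.aeval fun i ↦ orbitSum γ (fundamentalAntidominant b had i)

omit [Finite ι] in
lemma orbitSumHom_X (i : b.support) :
    orbitSumHom γ had (MvPolynomial.X i) = orbitSum γ (fundamentalAntidominant b had i) :=
  MvPolynomial.aeval_X _ _

lemma twist_orbitSumHom (w : P.weylGroup) (p : MvPolynomial b.support K) :
    TwistedGroupRing.twist γ w (orbitSumHom γ had p) = orbitSumHom γ had p := by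
  have h : (TwistedGroupRing.twist γ w).comp (orbitSumHom γ had) = orbitSumHom γ had := by
    refine MvPolynomial.algHom_ext fun i ↦ ?_
    rw [AlgHom.comp_apply, orbitSumHom_X, twist_orbitSum]
  exact DFunLike.congr_fun h p

omit [Finite ι] in
lemma orbitSumHom_eq_sum (p : MvPolynomial b.support K) :
    orbitSumHom γ had p =
      ∑ m ∈ p.support, p.coeff m • orbitSumHom γ had (MvPolynomial.monomial m 1) := by
  conv_lhs => rw [p.as_sum, map_sum]
  refine Finset.sum_congr rfl fun m _ ↦ ?_
  rw [← map_smul, MvPolynomial.smul_monomial, smul_eq_mul, mul_one]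

variable [P.IsReduced]

lemma hasLead_orbitSumHom_monomial (m : b.support →₀ ℕ) :
    HasLead (orbitSumHom γ had (MvPolynomial.monomial m 1)) (expWeight b had m) := by
  rw [orbitSumHom, MvPolynomial.aeval_monomial, _root_.map_one, one_mul]
  exact HasLead.prod fun i _ ↦
    (hasLead_orbitSum (antidominant_fundamentalAntidominant had i)).pow _

/-- Induction on a bound for the depth of the antidominant support, which determines an invariant
element: each step cancels the top layer by a combination of monomials. -/
lemma mem_range_orbitSumHom {f : TwistedGroupRing γ}
    (hf : ∀ w, TwistedGroupRing.twist γ w f = f) : f ∈ (orbitSumHom γ had).range := by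
  suffices h : ∀ (n : ℕ) (f : TwistedGroupRing γ), (∀ w, TwistedGroupRing.twist γ w f = f) →
      (∀ l, Antidominant b l → f.coeff l ≠ 0 → depth b l < n) → f ∈ (orbitSumHom γ had).range by
    obtain ⟨n, hn⟩ := (f.coeff.support.image fun l ↦ (depth b l).toNat).exists_nat_subset_range
    refine h n f hf fun l _ hl ↦ ?_
    have := hn (Finset.mem_image_of_mem _ (Finsupp.mem_support_iff.2 hl))
    rw [Finset.mem_range] at this
    lia
  clear! f
  intro n
  induction n with
  | zero =>
    intro f hf h
    -- Antidominant cocharacters have depth at least `0`, so no antidominant coefficient survives;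
    -- invariance carries this vanishing to whole orbits.
    have h0 : f = 0 := by
      refine ext_coeff fun l ↦ ?_
      obtain ⟨w, hw⟩ := exists_antidominant_smul b l
      have h1 : f.coeff (w • l) = 0 := by
        by_contra hne
        exact absurd hw.depth_nonneg (not_le.2 (by simpa using h _ hw hne))
      have h2 := coeff_twist w f l
      rw [hf w, h1] at h2
      exact (mul_eq_zero.1 h2.symm).resolve_left (γ.toFun w l).ne_zero
    exact h0 ▸ zero_mem _
  | succ n ih =>
    intro f hf h
    classical
    let s := f.coeff.support.preimage (expWeight b had) (expWeight_injective had).injOn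
    let p : MvPolynomial b.support K := ∑ m ∈ s with depth b (expWeight b had m) = n,
      MvPolynomial.monomial m (f.coeff (expWeight b had m))
    rw [← sub_add_cancel f (orbitSumHom γ had p)]
    refine add_mem (ih _ (fun w ↦ ?_) fun l hl hne ↦ ?_) ⟨p, rfl⟩
    · rw [map_sub, hf, twist_orbitSumHom]
    · obtain ⟨k, rfl⟩ := hl.exists_expWeight_eq had
      by_contra hk
      rw [not_lt] at hk
      have hp : (orbitSumHom γ had p).coeff (expWeight b had k) =
          ∑ m ∈ s with depth b (expWeight b had m) = n, f.coeff (expWeight b had m) *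
            (orbitSumHom γ had (MvPolynomial.monomial m 1)).coeff (expWeight b had k) := by
        rw [← coeffLin_apply, map_sum, map_sum]
        refine Finset.sum_congr rfl fun m _ ↦ ?_
        rw [← coeffLin_apply _ (orbitSumHom _ _ _), ← smul_eq_mul, ← map_smul, ← map_smul,
          MvPolynomial.smul_monomial, smul_eq_mul, mul_one]
      -- By `hk` the depth at `k` is at least `n`, too large for a non-leading term of a monomial of
      -- depth `n`.
      have hzero : ∀ m, depth b (expWeight b had m) = n → m ≠ k →
          (orbitSumHom γ had (MvPolynomial.monomial m 1)).coeff (expWeight b had k) = 0 := by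
        intro m hm hmk
        by_contra hne'
        have := (hasLead_orbitSumHom_monomial γ had m).depth_lt
          ((expWeight_injective had).ne hmk) hne'
        lia
      apply hne
      rw [← coeffLin_apply, map_sub, coeffLin_apply, coeffLin_apply, hp, sub_eq_zero]
      by_cases hks : k ∈ {m ∈ s | depth b (expWeight b had m) = n}
      · rw [Finset.sum_eq_single_of_mem k hks, (hasLead_orbitSumHom_monomial γ had k).coeff_eq_one,
          mul_one]
        intro m hm hmk
        rw [hzero m (Finset.mem_filter.1 hm).2 hmk, mul_zero]
      · rw [Finset.sum_eq_zero]
        -- A nonzero coefficient at `k` would force its depth to be exactly `n`, placing `k` in the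
        -- index set.
        · by_contra hfk
          have := h _ hl hfk
          refine hks (Finset.mem_filter.2 ⟨by simpa [s] using hfk, ?_⟩)
          push_cast at this
          lia
        · intro m hm
          rw [hzero m (Finset.mem_filter.1 hm).2 (ne_of_mem_of_not_mem hm hks), mul_zero]

variable [IsUltrametricDist K]

lemma norm_orbitSumHom_monomial_le (m : b.support →₀ ℕ) :
    ‖orbitSumHom γ had (MvPolynomial.monomial m 1)‖ ≤ 1 := by
  rw [orbitSumHom, MvPolynomial.aeval_monomial, _root_.map_one, one_mul, Finsupp.prod]
  have h : ∀ i, orbitSum γ (fundamentalAntidominant b had i) ∈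
      Submonoid.unitClosedBall (TwistedGroupRing γ) := fun i ↦
    mem_closedBall_zero_iff.2 (norm_orbitSum_le (antidominant_fundamentalAntidominant had i))
  exact mem_closedBall_zero_iff.1 (Submonoid.prod_mem _ fun i _ ↦ pow_mem (h i) (m i))

/-- Among the coefficients of maximal absolute value, choose an index `k` of maximal depth. At the
leading cocharacter of `k` all other monomials together contribute strictly less than `‖p.coeff k‖`,
so the ultrametric inequality leaves exactly this value. -/
lemma norm_coeff_le_norm_orbitSumHom (p : MvPolynomial b.support K) (m : b.support →₀ ℕ) :
    ‖p.coeff m‖ ≤ ‖orbitSumHom γ had p‖ := by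
  classical
  by_cases hm : p.coeff m = 0
  · simp [hm]
  obtain ⟨k₀, hk₀, hmax⟩ := p.support.exists_max_image (fun m ↦ ‖p.coeff m‖)
    ⟨m, MvPolynomial.mem_support_iff.2 hm⟩
  obtain ⟨k, hk, hkmax⟩ := Finset.exists_max_image {m ∈ p.support | ‖p.coeff m‖ = ‖p.coeff k₀‖}
    (fun m ↦ depth b (expWeight b had m)) ⟨k₀, by simpa using hk₀⟩
  rw [Finset.mem_filter] at hk
  obtain ⟨hks, hkn⟩ := hk
  rw [← hkn] at hmax
  have hpos : 0 < ‖p.coeff k‖ := norm_pos_iff.2 (MvPolynomial.mem_support_iff.1 hks)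
  refine (hmax m (MvPolynomial.mem_support_iff.2 hm)).trans ?_
  have hkdom := antidominant_expWeight (b := b) had k
  refine le_trans (le_of_eq ?_) (norm_coeff_le hkdom _)
  rw [← coeffLin_apply, orbitSumHom_eq_sum, map_sum, ← Finset.add_sum_erase _ _ hks, map_smul,
    coeffLin_apply, (hasLead_orbitSumHom_monomial γ had k).coeff_eq_one, smul_eq_mul, mul_one]
  have hlt : ‖∑ m ∈ p.support.erase k, coeffLin γ (expWeight b had k)
      (p.coeff m • orbitSumHom γ had (MvPolynomial.monomial m 1))‖ < ‖p.coeff k‖ := by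
    refine Finset.sum_induction _ (fun x ↦ ‖x‖ < ‖p.coeff k‖)
      (fun x y hx hy ↦ (IsUltrametricDist.norm_add_le_max x y).trans_lt (max_lt hx hy))
      (by simpa using hpos) fun m hm ↦ ?_
    obtain ⟨hmk, hms⟩ := Finset.mem_erase.1 hm
    rw [map_smul, coeffLin_apply, smul_eq_mul, norm_mul]
    -- A smaller coefficient stays smaller, as monomials have norm at most `1`. An equally large one
    -- belongs to a monomial of no greater depth, which does not involve the leading cocharacter of
    -- `k`.
    rcases (hmax m hms).lt_or_eq with hlt | heq
    · exact (mul_le_of_le_one_right (norm_nonneg _) ((norm_coeff_le hkdom _).trans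
        (norm_orbitSumHom_monomial_le γ had m))).trans_lt hlt
    · have h0 : (orbitSumHom γ had (MvPolynomial.monomial m 1)).coeff (expWeight b had k) = 0 := by
        by_contra hne
        exact (hkmax m (Finset.mem_filter.2 ⟨hms, heq.trans hkn⟩)).not_gt
          ((hasLead_orbitSumHom_monomial γ had m).depth_lt ((expWeight_injective had).ne hmk) hne)
      simpa [h0] using hpos
  rw [IsUltrametricDist.norm_add_eq_max_of_norm_ne_norm hlt.ne', max_eq_left hlt.le]

lemma norm_orbitSumHom_le {p : MvPolynomial b.support K} {C : ℝ} (hC : 0 ≤ C)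
    (h : ∀ m, ‖p.coeff m‖ ≤ C) : ‖orbitSumHom γ had p‖ ≤ C := by
  rw [orbitSumHom_eq_sum]
  refine IsUltrametricDist.norm_sum_le_of_forall_le_of_nonneg hC fun m _ ↦ ?_
  exact (norm_smul_le _ _).trans ((mul_le_of_le_one_right (norm_nonneg _)
    (norm_orbitSumHom_monomial_le γ had m)).trans (h m))

end Polynomial

end BanachHecke

end

noncomputable section

namespace BanachHecke

/-! ### Completeness of the Tate algebra and extension from polynomials -/

namespace TateAlgebra

open Filter
open scoped Topology

variable {K : Type*} [NormedField K] [IsUltrametricDist K] {σ : Type*}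

lemma norm_coeff_le (f : TateAlgebra K σ) (t : σ →₀ ℕ) : ‖MvPowerSeries.coeff t f.1‖ ≤ ‖f‖ :=
  le_ciSup (f := fun t ↦ ‖MvPowerSeries.coeff t f.1‖)
    (tendsto_coeff f).bddAbove_range_of_cofinite t

lemma norm_le {f : TateAlgebra K σ} {C : ℝ} (h : ∀ t, ‖MvPowerSeries.coeff t f.1‖ ≤ C) :
    ‖f‖ ≤ C := ciSup_le h

omit [IsUltrametricDist K] in
lemma isRestricted_one_iff {f : MvPowerSeries σ K} :
    MvPowerSeries.IsRestricted (fun _ ↦ 1) f ↔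
      Tendsto (fun t ↦ ‖MvPowerSeries.coeff t f‖) cofinite (𝓝 0) := by
  simp [MvPowerSeries.IsRestricted, Finsupp.prod]

/-- The Gauss norm is the sup norm on coefficients, and a uniform limit of families tending to `0`
tends to `0`. Completeness makes isometric images closed. -/
instance [CompleteSpace K] : CompleteSpace (TateAlgebra K σ) := by
  refine Metric.complete_of_cauchySeq_tendsto fun u hu ↦ ?_
  have hu' := Metric.cauchySeq_iff.1 hu
  have hdist : ∀ n m t, dist (MvPowerSeries.coeff t (u n).1) (MvPowerSeries.coeff t (u m).1) ≤
      dist (u n) (u m) := by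
    intro n m t
    rw [dist_eq_norm, dist_eq_norm, ← map_sub]
    exact norm_coeff_le (u n - u m) t
  have hlim : ∀ t, ∃ a, Tendsto (fun n ↦ MvPowerSeries.coeff t (u n).1) atTop (𝓝 a) := by
    refine fun t ↦ cauchySeq_tendsto_of_complete (Metric.cauchySeq_iff.2 fun ε hε ↦ ?_)
    obtain ⟨N, hN⟩ := hu' ε hε
    exact ⟨N, fun m hm n hn ↦ (hdist m n t).trans_lt (hN m hm n hn)⟩
  choose a ha using hlim
  have hunif : ∀ ε > 0, ∃ N, ∀ n ≥ N, ∀ t, ‖MvPowerSeries.coeff t (u n).1 - a t‖ ≤ ε := by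
    intro ε hε
    obtain ⟨N, hN⟩ := hu' ε hε
    refine ⟨N, fun n hn t ↦ ?_⟩
    -- The Cauchy estimate does not depend on `t`, and it survives the limit in the second index.
    refine le_of_tendsto ((ha t).const_sub _).norm ((eventually_ge_atTop N).mono fun m hm ↦ ?_)
    rw [← dist_eq_norm]
    exact (hdist n m t).trans (hN n hn m hm).le
  have hmem : (a : MvPowerSeries σ K) ∈ tateSubalgebra K σ := by
    refine isRestricted_one_iff.2 (Metric.tendsto_nhds.2 fun ε hε ↦ ?_)
    obtain ⟨N, hN⟩ := hunif (ε / 2) (half_pos hε)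
    filter_upwards [Metric.tendsto_nhds.1 (tendsto_coeff (u N)) (ε / 2) (half_pos hε)] with t ht
    rw [dist_zero_right, norm_norm] at ht ⊢
    have h1 := norm_sub_le (MvPowerSeries.coeff t (u N).1) (MvPowerSeries.coeff t (u N).1 - a t)
    rw [sub_sub_cancel] at h1
    have h2 := hN N le_rfl t
    change ‖a t‖ < ε
    linarith
  refine ⟨⟨a, hmem⟩, Metric.tendsto_atTop.2 fun ε hε ↦ ?_⟩
  obtain ⟨N, hN⟩ := hunif (ε / 2) (half_pos hε)
  refine ⟨N, fun n hn ↦ ?_⟩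
  rw [dist_eq_norm]
  refine lt_of_le_of_lt (norm_le fun t ↦ ?_) (half_lt_self hε)
  exact hN n hn t

variable (K σ) in
/-- The inclusion of the polynomial ring into the Tate algebra. -/
def ofPolynomial : MvPolynomial σ K →ₐ[K] TateAlgebra K σ :=
  MvPolynomial.aeval fun i ↦ X K i

lemma ofPolynomial_X (i : σ) : ofPolynomial K σ (MvPolynomial.X i) = X K i :=
  MvPolynomial.aeval_X _ _

lemma coe_ofPolynomial (p : MvPolynomial σ K) :
    (ofPolynomial K σ p : MvPowerSeries σ K) = (p : MvPowerSeries σ K) := by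
  have h : (tateSubalgebra K σ).val.comp (ofPolynomial K σ) =
      MvPolynomial.coeToMvPowerSeries.algHom K := by
    refine MvPolynomial.algHom_ext fun i ↦ ?_
    rw [AlgHom.comp_apply, ofPolynomial_X, MvPolynomial.coeToMvPowerSeries.algHom_apply]
    simp [X]
  simpa using! DFunLike.congr_fun h p

lemma coeff_ofPolynomial (p : MvPolynomial σ K) (t : σ →₀ ℕ) :
    MvPowerSeries.coeff t (ofPolynomial K σ p).1 = p.coeff t := by
  rw [coe_ofPolynomial, MvPolynomial.coeff_coe]

lemma ofPolynomial_injective : Function.Injective (ofPolynomial K σ) := by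
  intro p q h
  ext t
  rw [← coeff_ofPolynomial, h, coeff_ofPolynomial]

/-- Only finitely many coefficients have absolute value at least `r / 2`; truncation to these leaves
an error at most `r / 2`. -/
lemma denseRange_ofPolynomial : DenseRange (ofPolynomial K σ) := by
  classical
  refine Metric.denseRange_iff.2 fun f r hr ↦ ?_
  have hfin : {t | ¬ dist ‖MvPowerSeries.coeff t f.1‖ 0 < r / 2}.Finite :=
    Metric.tendsto_nhds.1 (tendsto_coeff f) (r / 2) (half_pos hr)
  refine ⟨∑ t ∈ hfin.toFinset, MvPolynomial.monomial t (MvPowerSeries.coeff t f.1), ?_⟩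
  rw [dist_eq_norm]
  refine lt_of_le_of_lt (norm_le fun t ↦ ?_) (half_lt_self hr)
  change ‖MvPowerSeries.coeff t (f.1 - (ofPolynomial K σ _).1)‖ ≤ _
  rw [map_sub, coeff_ofPolynomial, MvPolynomial.coeff_sum]
  simp only [MvPolynomial.coeff_monomial, Finset.sum_ite_eq', Set.Finite.mem_toFinset,
    Set.mem_ofPred_eq, dist_zero_right, norm_norm, not_lt]
  split_ifs with h
  · simpa using (half_pos hr).le
  · simpa using (not_le.1 h).le

lemma algHom_ext_of_continuous {B : Type*} [Ring B] [Algebra K B] [TopologicalSpace B] [T2Space B]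
    {φ ψ : TateAlgebra K σ →ₐ[K] B} (hφ : Continuous φ) (hψ : Continuous ψ)
    (h : ∀ i, φ (X K i) = ψ (X K i)) : φ = ψ := by
  have hp : φ.comp (ofPolynomial K σ) = ψ.comp (ofPolynomial K σ) :=
    MvPolynomial.algHom_ext fun i ↦ by
      rw [AlgHom.comp_apply, AlgHom.comp_apply, ofPolynomial_X, h]
  exact DFunLike.coe_injective (denseRange_ofPolynomial.equalizer hφ hψ
    (funext fun p ↦ DFunLike.congr_fun hp p))

/-- An isometric homomorphism from the polynomial ring with the Gauss norm to a Banach algebra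
extends to the Tate algebra. -/
lemma exists_continuous_extension {B : Type*} [NormedRing B] [NormedAlgebra K B] [CompleteSpace B]
    (f : MvPolynomial σ K →ₐ[K] B) (hf : ∀ p, ‖f p‖ = ‖ofPolynomial K σ p‖) :
    ∃ φ : TateAlgebra K σ →ₐ[K] B, Continuous φ ∧ ∀ p, φ (ofPolynomial K σ p) = f p := by
  -- The polynomial ring is replaced by its image, a dense subalgebra that inherits the Gauss norm,
  -- so that extension by uniform continuity applies.
  let e := AlgEquiv.ofInjective (ofPolynomial K σ) ofPolynomial_injective
  have he : ∀ p, ((e p : (ofPolynomial K σ).range) : TateAlgebra K σ) = ofPolynomial K σ p :=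
    fun _ ↦ rfl
  let g : (ofPolynomial K σ).range →ₐ[K] B := f.comp e.symm.toAlgHom
  have hg : Isometry g := AddMonoidHomClass.isometry_of_norm _ fun x ↦ by
    obtain ⟨p, rfl⟩ := e.surjective x
    change ‖f (e.symm (e p))‖ = ‖ofPolynomial K σ p‖
    rw [e.symm_apply_apply, hf]
  have hi : Isometry (ofPolynomial K σ).range.val := isometry_subtype_coe
  have hd : DenseRange (ofPolynomial K σ).range.val := by
    refine denseRange_ofPolynomial.mono ?_
    rintro - ⟨p, rfl⟩
    exact ⟨e p, rfl⟩
  let φ : TateAlgebra K σ →+* B := IsDenseInducing.extendRingHom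
    (i := (ofPolynomial K σ).range.val.toRingHom) (f := g.toRingHom) hi.isUniformInducing
    hd hg.uniformContinuous
  have hφ : ∀ p, φ (ofPolynomial K σ p) = f p := by
    intro p
    have h1 : φ (e p : (ofPolynomial K σ).range) = g (e p) :=
      (hi.isUniformInducing.isDenseInducing hd).extend_eq hg.continuous (e p)
    rw [← he, h1]
    change f (e.symm (e p)) = f p
    rw [e.symm_apply_apply]
  refine ⟨{ φ with commutes' := fun c ↦ ?_ }, ?_, hφ⟩
  · have := hφ (algebraMap K _ c)
    rw [AlgHom.commutes, AlgHom.commutes] at this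
    exact this
  · exact (uniformContinuous_uniformly_extend hi.isUniformInducing hd
      hg.uniformContinuous).continuous

end TateAlgebra

end BanachHecke

end

noncomputable section

namespace BanachHecke

open RootPairing

/-! ### Invariants of the completion and surjectivity -/

section Invariants

variable {ι X Λ : Type*} [AddCommGroup X] [AddCommGroup Λ] [Finite ι] {P : RootDatum ι X Λ}
  [P.IsReduced] {b : P.Base} {K : Type*} [NormedField K] [IsUltrametricDist K]
  (γ : WeylCocycle b K)

namespace CompletedGroupRing

lemma continuous_twist (w : P.weylGroup) : Continuous (twist γ w) :=
  UniformSpace.Completion.continuous_map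

lemma twist_mul (v w : P.weylGroup) (f : CompletedGroupRing γ) :
    twist γ (v * w) f = twist γ v (twist γ w f) := by
  induction f using UniformSpace.Completion.induction_on with
  | hp =>
    exact isClosed_eq (continuous_twist γ _) ((continuous_twist γ v).comp (continuous_twist γ w))
  | ih f =>
    simp only [twist_coe]
    congr 1
    induction f using TwistedGroupRing.induction_linear with
    | h0 => simp
    | hadd f g hf hg => rw [_root_.map_add, _root_.map_add, _root_.map_add, hf, hg]
    | hs l c =>
      rw [TwistedGroupRing.twist_single, TwistedGroupRing.twist_single,
        TwistedGroupRing.twist_single, mul_smul, γ.map_mul, Units.val_mul, mul_assoc]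

/-- The projection of `K⟨Λ; γ⟩` to the invariants by averaging over the Weyl group. -/
def average (f : CompletedGroupRing γ) : invariants γ :=
  ⟨(Nat.card P.weylGroup : K)⁻¹ • ∑ᶠ w : P.weylGroup, twist γ w f, fun v ↦ by
    have := Fintype.ofFinite P.weylGroup
    rw [map_smul, finsum_eq_sum_of_fintype, map_sum]
    congr 1
    exact Fintype.sum_equiv (Equiv.mulLeft v) _ _ fun w ↦ (twist_mul γ v w f).symm⟩

/-- Continuity is all that surjectivity needs; averaging need not be norm-decreasing, as the inverse
of `|W|` may have absolute value greater than `1`. -/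
lemma continuous_average : Continuous (average γ) := by
  have := Fintype.ofFinite P.weylGroup
  refine Continuous.subtype_mk ?_ _
  simp only [finsum_eq_sum_of_fintype]
  exact (continuous_finsetSum _ fun w _ ↦ continuous_twist γ w).const_smul (Nat.card P.weylGroup : K)⁻¹

lemma average_coe [CharZero K] (f : invariants γ) : average γ f = f := by
  have := Fintype.ofFinite P.weylGroup
  have hW : (Nat.card P.weylGroup : K) ≠ 0 := Nat.cast_ne_zero.2 Nat.card_pos.ne'
  apply Subtype.ext
  change (Nat.card P.weylGroup : K)⁻¹ • ∑ᶠ w : P.weylGroup, twist γ w f = f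
  rw [finsum_eq_sum_of_fintype, Finset.sum_congr rfl fun w _ ↦ f.2 w, Finset.sum_const,
    Finset.card_univ, ← Nat.card_eq_fintype_card, ← Nat.cast_smul_eq_nsmul K, inv_smul_smul₀ hW]

/-- Averaging preserves `K[Λ]`, which reduces surjectivity to the algebraic statement there. -/
lemma exists_coe_eq_average_coe (f : TwistedGroupRing γ) :
    ∃ g : TwistedGroupRing γ, (average γ f : CompletedGroupRing γ) = g := by
  have := Fintype.ofFinite P.weylGroup
  refine ⟨(Nat.card P.weylGroup : K)⁻¹ • ∑ w, TwistedGroupRing.twist γ w f, ?_⟩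
  change (Nat.card P.weylGroup : K)⁻¹ • ∑ᶠ w : P.weylGroup, twist γ w f = _
  rw [finsum_eq_sum_of_fintype, UniformSpace.Completion.coe_smul]
  congr 1
  simp only [twist_coe]
  exact (map_sum UniformSpace.Completion.coeRingHom _ _).symm

lemma isClosed_invariants : IsClosed (invariants γ : Set (CompletedGroupRing γ)) := by
  have h : (invariants γ : Set (CompletedGroupRing γ)) = ⋂ w, {f | twist γ w f = f} := by
    ext f
    simp [invariants]
  rw [h]
  exact isClosed_iInter fun w ↦ isClosed_eq (continuous_twist γ w) continuous_id

instance : CompleteSpace (invariants γ) :=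
  (isClosed_invariants γ).completeSpace_coe

end CompletedGroupRing

open CompletedGroupRing

variable (had : IsAdjoint P)

/-- The homomorphism from the polynomial ring to the invariants mapping the variables to the
elements `σ_{λ_i}`. -/
def sigmaHom : MvPolynomial b.support K →ₐ[K] invariants γ :=
  MvPolynomial.aeval fun i ↦ sigma γ (fundamentalAntidominant b had i)

lemma coe_sigmaHom (p : MvPolynomial b.support K) :
    (sigmaHom γ had p : CompletedGroupRing γ) = (orbitSumHom γ had p : TwistedGroupRing γ) := by
  let coeHom : TwistedGroupRing γ →ₐ[K] CompletedGroupRing γ :=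
    { UniformSpace.Completion.coeRingHom with commutes' := fun _ ↦ rfl }
  have h : (invariants γ).val.comp (sigmaHom γ had) = coeHom.comp (orbitSumHom γ had) := by
    refine MvPolynomial.algHom_ext fun i ↦ ?_
    rw [AlgHom.comp_apply, AlgHom.comp_apply, orbitSumHom_X, sigmaHom, MvPolynomial.aeval_X]
    rfl
  exact DFunLike.congr_fun h p

lemma norm_sigmaHom (p : MvPolynomial b.support K) :
    ‖sigmaHom γ had p‖ = ‖TateAlgebra.ofPolynomial K b.support p‖ := by
  change ‖(sigmaHom γ had p : CompletedGroupRing γ)‖ = _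
  rw [coe_sigmaHom, UniformSpace.Completion.norm_coe]
  refine le_antisymm (norm_orbitSumHom_le γ had (norm_nonneg _) fun m ↦ ?_)
    (TateAlgebra.norm_le fun m ↦ ?_)
  · rw [← TateAlgebra.coeff_ofPolynomial]
    exact TateAlgebra.norm_coeff_le _ m
  · rw [TateAlgebra.coeff_ofPolynomial]
    exact norm_coeff_le_norm_orbitSumHom γ had p m

variable {γ had} {φ : TateAlgebra K b.support →ₐ[K] invariants γ}
  (hφ : ∀ i : b.support,
    φ (TateAlgebra.X K i) = sigma γ (fundamentalAntidominant b had i))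

include hφ

lemma apply_ofPolynomial_eq_sigmaHom (p : MvPolynomial b.support K) :
    φ (TateAlgebra.ofPolynomial K b.support p) = sigmaHom γ had p := by
  have h : φ.comp (TateAlgebra.ofPolynomial K b.support) = sigmaHom γ had :=
    MvPolynomial.algHom_ext fun i ↦ by
      rw [AlgHom.comp_apply, TateAlgebra.ofPolynomial_X, hφ, sigmaHom, MvPolynomial.aeval_X]
  exact DFunLike.congr_fun h p

lemma isometry_of_apply_X (hcont : Continuous φ) : Isometry φ := by
  refine AddMonoidHomClass.isometry_of_norm φ fun f ↦ ?_
  refine TateAlgebra.denseRange_ofPolynomial.induction_on f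
    (isClosed_eq hcont.norm continuous_norm) fun p ↦ ?_
  rw [apply_ofPolynomial_eq_sigmaHom hφ, norm_sigmaHom]

lemma surjective_of_apply_X [CompleteSpace K] [CharZero K] (hcont : Continuous φ) :
    Function.Surjective φ := by
  have hclosed : IsClosed (Set.range φ) :=
    (isometry_of_apply_X hφ hcont).isClosedEmbedding.isClosed_range
  -- Density of `K[Λ]` is available in the whole completion, not a priori among the invariants, so
  -- the claim is proved for averages of arbitrary elements.
  have h : ∀ f : CompletedGroupRing γ, average γ f ∈ Set.range φ := by
    intro f
    induction f using UniformSpace.Completion.induction_on with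
    | hp => exact hclosed.preimage (continuous_average γ)
    | ih f =>
      obtain ⟨g, hg⟩ := exists_coe_eq_average_coe γ f
      have hinv : ∀ w, TwistedGroupRing.twist γ w g = g := by
        intro w
        have h1 := (average γ f).2 w
        rw [hg, twist_coe] at h1
        exact UniformSpace.Completion.coe_injective _ h1
      obtain ⟨p, hp⟩ := mem_range_orbitSumHom γ had hinv
      refine ⟨TateAlgebra.ofPolynomial K b.support p, Subtype.ext ?_⟩
      rw [apply_ofPolynomial_eq_sigmaHom hφ, coe_sigmaHom, hg]
      exact congrArg _ hp
  exact fun f ↦ average_coe γ f ▸ h f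

end Invariants

end BanachHecke

end

theorem proposition2p6
    {p : ℕ} [Fact p.Prime]
    {K : Type*} [NormedField K] [NormedAlgebra ℚ_[p] K] [CompleteSpace K] [IsUltrametricDist K]
    {ι X Λ : Type*} [Finite ι] [AddCommGroup X] [AddCommGroup Λ]
    [Module.Finite ℤ X] [Module.Finite ℤ Λ]
    (P : RootDatum ι X Λ) [P.IsReduced] (b : P.Base)
    (γ : BanachHecke.WeylCocycle b K)
    (hss : BanachHecke.IsSemisimple P) (had : BanachHecke.IsAdjoint P) :
    (∃! φ : BanachHecke.TateAlgebra K b.support →ₐ[K] BanachHecke.CompletedGroupRing.invariants γ,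
      Continuous φ ∧
        ∀ i : b.support, φ (BanachHecke.TateAlgebra.X K i) =
          BanachHecke.sigma γ (BanachHecke.fundamentalAntidominant b had i)) ∧
    ∀ φ : BanachHecke.TateAlgebra K b.support →ₐ[K] BanachHecke.CompletedGroupRing.invariants γ,
      Continuous φ →
      (∀ i : b.support, φ (BanachHecke.TateAlgebra.X K i) =
          BanachHecke.sigma γ (BanachHecke.fundamentalAntidominant b had i)) →
      Isometry φ ∧ Function.Bijective φ := by
  -- Characteristic zero makes the order of `W` invertible, as averaging requires.
  have hchar : CharZero K := charZero_of_injective_algebraMap (algebraMap ℚ_[p] K).injective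
  refine ⟨?_, fun φ hcont hφ ↦ ?_⟩
  · obtain ⟨φ, hcont, hφ⟩ := BanachHecke.TateAlgebra.exists_continuous_extension
      (BanachHecke.sigmaHom γ had) (BanachHecke.norm_sigmaHom γ had)
    have hX : ∀ i : b.support, φ (BanachHecke.TateAlgebra.X K i) =
        BanachHecke.sigma γ (BanachHecke.fundamentalAntidominant b had i) := by
      intro i
      rw [← BanachHecke.TateAlgebra.ofPolynomial_X, hφ]
      exact MvPolynomial.aeval_X _ _
    exact ⟨φ, ⟨hcont, hX⟩, fun ψ hψ ↦ BanachHecke.TateAlgebra.algHom_ext_of_continuous hψ.1 hcont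
      fun i ↦ by rw [hψ.2, hX]⟩
  · have hiso := BanachHecke.isometry_of_apply_X hφ hcont
    exact ⟨hiso, hiso.injective, BanachHecke.surjective_of_apply_X hφ hcont⟩
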